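/- **Setting.** Let $\mathcal H,\mathcal K$ be finite-dimensional real Hilbert spaces, $C\subseteq\mathcal H$ closed, $A\colon\mathcal H\to\mathcal K$ linear with adjoint $A^*$, $f\colon\mathcal H\to(-\infty,+\infty]$ lower semicontinuous with $C\cap\operatorname{dom} f\neq\varnothing$, where $\operatorname{dom} f=\{x: f(x)<+\infty\}$, $h\colon\mathcal K\to\mathbb R$ differentiable with $\nabla h$ Lipschitz continuous with constant $\ell\ge 0$, and $g\colon\mathcal H\to(-\infty,+\infty]$ finite and continuous on an open convex set $O\supseteq C$ with $g+\frac{\beta}{2}\|\cdot\|^2$ convex on $O$, where $\beta\geq 0$. Put $F(x)=f(x)+h(Ax)-g(x)$, and let $\iota_C$ be the indicator function of $C$ ($0$ on $C$, $+\infty$ elsewhere; $F+\iota_C$ is $+\infty$ off $C$). For an extended-real-valued function $\varphi$ on a Hilbert space and a point $x$ with $\varphi(x)$ finite, the Fréchet subdifferential is $\widehat\partial\varphi(x)=\{v:\liminf_{y\to x}\frac{\varphi(y)-\varphi(x)-\langle v,y-x\rangle}{\|y-x\|}\ge 0\}$, and the limiting subdifferential $\partial_L\varphi(x)$ is the set of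 limits of sequences $v_k\in\widehat\partial\varphi(y_k)$ with $y_k\to x$, $\varphi(y_k)\to\varphi(x)$; both are empty where $\varphi$ is not finite, and $\operatorname{dom}\partial_L\varphi=\{x:\partial_L\varphi(x)\neq\varnothing\}$. A point $x\in C$ is *stationary* if $0\in\partial_L(f+\iota_C+h\circ A-g)(x)$. A function $\varphi$ has the *Kurdyka–Łojasiewicz (KL) property* at $\bar z\in\operatorname{dom}\partial_L\varphi$ if there are $\eta\in(0,+\infty]$, a neighbourhood $V$ of $\bar z$ and a continuous concave $\phi\colon[0,\eta)\to[0,+\infty)$ with $\phi(0)=0$, continuously differentiable with $\phi'>0$ on $(0,\eta)$, such that $\phi'(\varphi(z)-\varphi(\bar z))\operatorname{dist}(0,\partial_L\varphi(z))\ge 1$ for all $z\in V$ with $\varphi(\bar z)<\varphi(z)<\varphi(\bar z)+\eta$ (where $\operatorname{dist}(0,\varnothing)=+\infty$). It has the KL property *with exponent* $\theta\in[0,1)$ if one can take $\phi(t)=\kappa t^{1-\theta}$ for some $\kappa>0$. **Algorithm.** Let $\overline\lambda,\overline\mu\ge 0$, $\delta>0$, and $x_{-1}=x_0\in C$. Let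 $(x_n)_{n\ge0}$ be such that for every $n\ge 0$ there are $g_n\in\partial_L g(x_n)$, $\tau_n\in\bigl(0,1/(\beta+2\delta+\ell\|A\|^2(2\overline\lambda+1)+2\overline\mu)\bigr]$, $\lambda_n\in[0,\overline\lambda]$, $\mu_n\in[0,\overline\mu\tau_n]$ with, for $u_n=x_n+\lambda_n(x_n-x_{n-1})$ and $v_n=x_n+\mu_n(x_n-x_{n-1})$, $$x_{n+1}\in\operatorname*{argmin}_{x\in C}\Bigl(f(x)+\tfrac1{2\tau_n}\|x-v_n+\tau_nA^*\nabla h(Au_n)-\tau_n g_n\|^2\Bigr).$$ **Theorem.** Suppose that $F$ is bounded from below on $C$, that $\{x\in C: F(x)\le F(x_0)\}$ is bounded, that $g$ is finite and differentiable on an open set containing $C\cap\operatorname{dom} f$ with $\nabla g$ Lipschitz continuous on $C\cap\operatorname{dom} f$, and that $\liminf_{n\to\infty}\tau_n>0$. Let $$G(x,y)=F(x)+\iota_C(x)+c\|x-y\|^2,\qquad c=\tfrac12(\ell\|A\|^2\overline\lambda+\overline\mu),$$ on the Hilbert space $\mathcal H\times\mathcal H$, and suppose that $G$ has the KL property at $(\bar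 x,\bar x)$ for every $\bar x\in C\cap\operatorname{dom} f$ with $(\bar x,\bar x)\in\operatorname{dom}\partial_LG$. Then: 1. $(x_n)$ converges to a stationary point $x^*$, and $\sum_{n=0}^\infty\|x_{n+1}-x_n\|<+\infty$. 2. Suppose further that, for some $\theta\in[0,1)$, $G$ has the KL property with exponent $\theta$ at all these points $(\bar x,\bar x)$. - (a) If $\theta=0$, then there is $N$ with $x_n=x^*$ for all $n\ge N$. - (b) If $\theta\in(0,\frac12]$, then there are $\gamma>0$ and $\rho\in(0,1)$ such that $\|x_n-x^*\|\le\gamma\rho^{n/2}$ for all $n\ge 0$, and $|F(x_n)-F(x^*)|\le\gamma\rho^n$ for all $n\ge 1$, and also for $n=0$ if $f(x_0)<+\infty$. - (c) If $\theta\in(\frac12,1)$, then there is $\gamma>0$ such that, for all $n\ge1$, $\|x_n-x^*\|\le\gamma n^{-\frac{1-\theta}{2\theta-1}}$ and $|F(x_n)-F(x^*)|\le\gamma n^{-\frac{2-2\theta}{2\theta-1}}$. -/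

import Mathlib

open Filter Topology
open scoped NNReal ENNReal RealInnerProductSpace

noncomputable section

namespace ProxSubgrad

/-- The domain of an extended-real-valued function: the points where it is not `+∞`. -/
def dom {E : Type*} (f : E → EReal) : Set E := {x | f x < ⊤}

section Subdifferential

variable {E : Type*} [NormedAddCommGroup E] [InnerProductSpace ℝ E]

/-- The Fréchet subdifferential (empty where `f` is not finite). The inequality
`liminf_{y → x} (f y - f x - ⟪v, y - x⟫) / ‖y - x‖ ≥ 0` is written out with `ε`:
for every `ε > 0`, `f y ≥ f x + ⟪v, y - x⟫ - ε ‖y - x‖` for all `y` near `x`. -/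
def frechetSubdiff (f : E → EReal) (x : E) : Set E :=
  {v | f x ≠ ⊥ ∧ f x ≠ ⊤ ∧ ∀ ε : ℝ, 0 < ε →
    ∀ᶠ y in 𝓝 x, f x + ((⟪v, y - x⟫ - ε * ‖y - x‖ : ℝ) : EReal) ≤ f y}

/-- The limiting subdifferential (empty where `f` is not finite): limits of Fréchet subgradients
`vₙ` at points `yₙ → x` with `f yₙ → f x`. -/
def limitingSubdiff (f : E → EReal) (x : E) : Set E :=
  {v | f x ≠ ⊥ ∧ f x ≠ ⊤ ∧ ∃ (y : ℕ → E) (w : ℕ → E),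
    Tendsto y atTop (𝓝 x) ∧ Tendsto (fun n => f (y n)) atTop (𝓝 (f x)) ∧
    Tendsto w atTop (𝓝 v) ∧ ∀ n, w n ∈ frechetSubdiff f (y n)}

/-- The domain of the limiting subdifferential. -/
def domLimitingSubdiff (f : E → EReal) : Set E := {x | (limitingSubdiff f x).Nonempty}

/-- The Kurdyka–Łojasiewicz inequality for `G` at `z` with desingularizing function `φ`:
there are `η ∈ (0, +∞]` and a neighbourhood `V` of `z` such that `φ` is a continuous concave
function from `[0, η)` to `[0, +∞)`, continuously differentiable with `φ' > 0` on `(0, η)`,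
`φ 0 = 0`, and `φ' (G y - G z) * dist (0, ∂_L G y) ≥ 1` for all `y ∈ V` with
`G z < G y < G z + η`. The distance to the empty set is `+∞`. -/
def KLInequality (G : E → EReal) (z : E) (φ : ℝ → ℝ) : Prop :=
  ∃ η : EReal, 0 < η ∧ ∃ V ∈ 𝓝 z,
    ContinuousOn φ {t : ℝ | 0 ≤ t ∧ (t : EReal) < η} ∧
    ConcaveOn ℝ {t : ℝ | 0 ≤ t ∧ (t : EReal) < η} φ ∧
    (∀ t : ℝ, 0 ≤ t → (t : EReal) < η → 0 ≤ φ t) ∧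
    ContDiffOn ℝ 1 φ {t : ℝ | 0 < t ∧ (t : EReal) < η} ∧
    (∀ t : ℝ, 0 < t → (t : EReal) < η → 0 < deriv φ t) ∧
    φ 0 = 0 ∧
    ∀ y ∈ V, G z < G y → G y < G z + η →
      1 ≤ ENNReal.ofReal (deriv φ (G y - G z).toReal) *
        Metric.infEDist (0 : E) (limitingSubdiff G y)

/-- The Kurdyka–Łojasiewicz property of `G` at a point `z` (meant for `z ∈ dom ∂_L G`). -/
def KLProperty (G : E → EReal) (z : E) : Prop :=
  ∃ φ : ℝ → ℝ, KLInequality G z φ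

/-- The Kurdyka–Łojasiewicz property of `G` at `z` with exponent `θ`: the desingularizing
function can be taken of the form `t ↦ κ t ^ (1 - θ)` with `κ > 0`. -/
def KLPropertyWithExponent (G : E → EReal) (z : E) (θ : ℝ) : Prop :=
  ∃ κ : ℝ, 0 < κ ∧ KLInequality G z (fun t => κ * t ^ (1 - θ))

end Subdifferential

section Problem

variable {H K : Type*} [NormedAddCommGroup H] [InnerProductSpace ℝ H] [CompleteSpace H]
  [NormedAddCommGroup K] [InnerProductSpace ℝ K] [CompleteSpace K]

/-- The objective function `F x = f x + h (A x) - g x`. -/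
def objective (f : H → EReal) (h : K → ℝ) (A : H →L[ℝ] K) (g : H → EReal) (x : H) : EReal :=
  f x + (h (A x) : EReal) - g x

open Classical in
/-- The sum `φ + ι_C` with the indicator function of `C`. It is `+∞` outside `C`, whatever the
value of `φ` there. -/
def addIndicator (C : Set H) (φ : H → EReal) (x : H) : EReal :=
  if x ∈ C then φ x else ⊤

/-- `x` is a stationary point of the problem of minimizing `F = f + h ∘ A - g` over `C`:
`x ∈ C` and `0 ∈ ∂_L (f + ι_C + h ∘ A - g) x`. -/
def IsStationaryPoint (C : Set H) (f : H → EReal) (h : K → ℝ) (A : H →L[ℝ] K) (g : H → EReal)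
    (x : H) : Prop :=
  x ∈ C ∧ (0 : H) ∈ limitingSubdiff (addIndicator C (objective f h A g)) x

/-- The function `G (x, y) = F x + ι_C x + c ‖x - y‖ ^ 2` on the Hilbert space `H × H`. -/
def merit (C : Set H) (f : H → EReal) (h : K → ℝ) (A : H →L[ℝ] K) (g : H → EReal) (c : ℝ)
    (z : WithLp 2 (H × H)) : EReal :=
  addIndicator C (objective f h A g) z.fst + ((c * ‖z.fst - z.snd‖ ^ 2 : ℝ) : EReal)

/-- `x` is a sequence generated by the proximal subgradient algorithm with extrapolation, with
subgradients `s n ∈ ∂_L g (x n)`, extrapolation parameters `lam n`, `mu n` and step sizes `τ n`.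
The starting convention `x_{-1} = x_0` is built in: `x (n - 1)` is a subtraction of natural
numbers, so that it means `x 0` for `n = 0`. -/
structure IsAlgorithmSequence (C : Set H) (f : H → EReal) (h : K → ℝ) (A : H →L[ℝ] K)
    (g : H → EReal) (β ℓ lamBar muBar δ : ℝ) (x s : ℕ → H) (lam mu τ : ℕ → ℝ) : Prop where
  start_mem : x 0 ∈ C
  subgrad_mem : ∀ n, s n ∈ limitingSubdiff g (x n)
  lam_mem : ∀ n, lam n ∈ Set.Icc 0 lamBar
  tau_mem : ∀ n, τ n ∈
    Set.Ioc 0 (1 / (β + 2 * δ + ℓ * ‖A‖ ^ 2 * (2 * lamBar + 1) + 2 * muBar))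
  mu_mem : ∀ n, mu n ∈ Set.Icc 0 (muBar * τ n)
  step_mem : ∀ n, x (n + 1) ∈ C
  step_min : ∀ n, IsMinOn
    (fun y : H => f y + ((1 / (2 * τ n) *
      ‖y - (x n + mu n • (x n - x (n - 1)))
        + τ n • ContinuousLinearMap.adjoint A
            (gradient h (A (x n + lam n • (x n - x (n - 1)))))
        - τ n • s n‖ ^ 2 : ℝ) : EReal)) C (x (n + 1))

end Problem

end ProxSubgrad

end

/-! The iterates are a descent sequence for the merit function `G`, and the Kurdyka–Łojasiewicz
machinery applies to any such sequence.

Three facts about the algorithm are needed. Decrease: comparing the new iterate with the old one in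
the proximal subproblem, and adding the descent lemma for `h` and the subgradient inequality for the
weakly convex `g`, shows that `G (x (n + 1), x n)` drops by at least `δ` times the squared step; the
quadratic term of `G` stores the error caused by extrapolation (`descent_of_step`). Small
subgradients: the optimality condition and the Lipschitz gradients of `h` and `g` give a Fréchet
subgradient of `F + ι_C` bounded by the last two steps (`exists_subgradient_bound`). Continuity of
values: `f` is only lower semicontinuous, but comparing the iterates with a cluster point `a` in the
subproblem gives the missing upper bound, so the merit values tend to `F a` (`exists_f_le`,
`exists_mapClusterPt`). Passing to the limit in the subgradients makes `a` stationary.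

Near `(a, a)`, concavity of the desingularizing function `φ` turns decrease and small subgradients
into a recursion: each step is at most a telescoping difference of `φ`-values plus a quarter of the
two preceding steps (`IsDescentSequence.exists_recursion`). It traps the iterates near `a` and makes
the steps summable. With `φ t = κ t ^ (1 - θ)`, the gap `r` between the merit values and their limit
satisfies `r (n + 2) ^ (2 * θ) ≤ K * (r n - r (n + 2))`; it decays geometrically or like a power
according to `θ`, and it controls both the distance to the limit and the objective values. -/

namespace ProxSubgrad

/-! ### Subgradients of weakly convex functions and the descent lemma -/

section Subgradients

variable {E : Type*} [NormedAddCommGroup E] [InnerProductSpace ℝ E]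

/-- Convexity inequality for a weakly convex function along a segment. -/
theorem weaklyConvex_segment {O : Set E} {φ : E → ℝ} {β : ℝ}
    (hconv : ConvexOn ℝ O (fun x => φ x + β / 2 * ‖x‖ ^ 2)) {x y : E} (hx : x ∈ O) (hy : y ∈ O)
    {t : ℝ} (ht0 : 0 ≤ t) (ht1 : t ≤ 1) :
    φ (x + t • (y - x)) ≤
      (1 - t) * φ x + t * φ y + β / 2 * (t * (1 - t)) * ‖y - x‖ ^ 2 := by
  have h := hconv.2 hx hy (sub_nonneg.2 ht1) ht0 (by ring)
  have e : (1 - t) • x + t • y = x + t • (y - x) := by module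
  rw [e] at h
  simp only [smul_eq_mul] at h
  have h1 : ‖x + t • (y - x)‖ ^ 2 = ‖x‖ ^ 2 + 2 * t * ⟪x, y - x⟫ + t ^ 2 * ‖y - x‖ ^ 2 := by
    rw [norm_add_sq_real, inner_smul_right, norm_smul, mul_pow, Real.norm_eq_abs, sq_abs]; ring
  have h2 : ‖y‖ ^ 2 = ‖x‖ ^ 2 + 2 * ⟪x, y - x⟫ + ‖y - x‖ ^ 2 := by
    conv_lhs => rw [show y = x + (y - x) by abel]
    rw [norm_add_sq_real]
  rw [h1, h2] at h
  linarith

/-- The Fréchet inequality is only local, and weak convexity makes it global: apply it at `x + t •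
(y - x)` for small `t`, bound the value there by the chord, divide by `t` and let `ε` tend to `0`.
-/
theorem weaklyConvex_le_of_frechetSubdiff {O : Set E} {g : E → EReal} {β : ℝ} (hβ : 0 ≤ β)
    (hO : IsOpen O) (hbot : ∀ x, g x ≠ ⊥) (hfin : ∀ x ∈ O, g x ≠ ⊤)
    (hconv : ConvexOn ℝ O (fun x => (g x).toReal + β / 2 * ‖x‖ ^ 2)) {x v : E} (hx : x ∈ O)
    (hv : v ∈ frechetSubdiff g x) {y : E} (hy : y ∈ O) :
    (g x).toReal + ⟪v, y - x⟫ - β / 2 * ‖y - x‖ ^ 2 ≤ (g y).toReal := by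
  obtain ⟨-, -, hv⟩ := hv
  have key : ∀ ε : ℝ, 0 < ε →
      (g x).toReal + ⟪v, y - x⟫ - β / 2 * ‖y - x‖ ^ 2 - ε * ‖y - x‖ ≤ (g y).toReal := by
    intro ε hε
    have hcont : Tendsto (fun t : ℝ => x + t • (y - x)) (𝓝[>] 0) (𝓝 x) := by
      have : Continuous (fun t : ℝ => x + t • (y - x)) := by fun_prop
      have h := this.tendsto 0
      simp only [zero_smul, add_zero] at h
      exact h.mono_left nhdsWithin_le_nhds
    have h1 := hcont.eventually (hv ε hε)
    have h2 := hcont.eventually (hO.mem_nhds hx)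
    have h3 : ∀ᶠ t : ℝ in 𝓝[>] 0, t < 1 := nhdsWithin_le_nhds (Iio_mem_nhds one_pos)
    obtain ⟨t, h1, h2, h3, h4⟩ := (h1.and (h2.and (h3.and self_mem_nhdsWithin))).exists
    have ht : 0 < t := h4
    have hs := weaklyConvex_segment hconv hx hy ht.le h3.le
    rw [← EReal.coe_toReal (hfin _ hx) (hbot _), ← EReal.coe_toReal (hfin _ h2) (hbot _),
      ← EReal.coe_add, EReal.coe_le_coe_iff] at h1
    simp only [add_sub_cancel_left, inner_smul_right, norm_smul, Real.norm_eq_abs,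
      abs_of_pos ht] at h1
    have h5 : t * ((g x).toReal + ⟪v, y - x⟫ - β / 2 * ‖y - x‖ ^ 2 - ε * ‖y - x‖)
        ≤ t * (g y).toReal := by
      have : 0 ≤ β / 2 * t ^ 2 * ‖y - x‖ ^ 2 := by positivity
      linarith
    exact le_of_mul_le_mul_left h5 ht
  have hlim : Tendsto (fun ε : ℝ => (g x).toReal + ⟪v, y - x⟫ - β / 2 * ‖y - x‖ ^ 2
      - ε * ‖y - x‖) (𝓝[>] 0) (𝓝 ((g x).toReal + ⟪v, y - x⟫ - β / 2 * ‖y - x‖ ^ 2)) := by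
    have : Continuous (fun ε : ℝ => (g x).toReal + ⟪v, y - x⟫ - β / 2 * ‖y - x‖ ^ 2
      - ε * ‖y - x‖) := by fun_prop
    have h := this.tendsto 0
    simp only [zero_mul, sub_zero] at h
    exact h.mono_left nhdsWithin_le_nhds
  exact le_of_tendsto hlim (eventually_nhdsWithin_of_forall key)

/-- A limiting subgradient of a weakly convex function satisfies the subgradient inequality up to
a quadratic term. -/
theorem weaklyConvex_le_of_limitingSubdiff {O : Set E} {g : E → EReal} {β : ℝ} (hβ : 0 ≤ β)
    (hO : IsOpen O) (hbot : ∀ x, g x ≠ ⊥) (hfin : ∀ x ∈ O, g x ≠ ⊤)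
    (hconv : ConvexOn ℝ O (fun x => (g x).toReal + β / 2 * ‖x‖ ^ 2)) {x v : E} (hx : x ∈ O)
    (hv : v ∈ limitingSubdiff g x) {y : E} (hy : y ∈ O) :
    (g x).toReal + ⟪v, y - x⟫ - β / 2 * ‖y - x‖ ^ 2 ≤ (g y).toReal := by
  obtain ⟨hb, ht, z, w, hz, hgz, hw, hmem⟩ := hv
  have hg := (EReal.tendsto_toReal ht hb).comp hgz
  have hyz : Tendsto (fun n => y - z n) atTop (𝓝 (y - x)) := tendsto_const_nhds.sub hz
  have hlim : Tendsto (fun n => (g (z n)).toReal + ⟪w n, y - z n⟫ - β / 2 * ‖y - z n‖ ^ 2) atTop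
      (𝓝 ((g x).toReal + ⟪v, y - x⟫ - β / 2 * ‖y - x‖ ^ 2)) :=
    (hg.add (hw.inner hyz)).sub ((hyz.norm.pow 2).const_mul _)
  refine le_of_tendsto hlim ?_
  filter_upwards [hz.eventually (hO.mem_nhds hx)] with n hn
  exact weaklyConvex_le_of_frechetSubdiff hβ hO hbot hfin hconv hn (hmem n) hy

/-- At a point of differentiability the gradient is the only limiting subgradient of a weakly
convex function. -/
theorem weaklyConvex_limitingSubdiff_eq_gradient [CompleteSpace E] {O : Set E} {g : E → EReal}
    {β : ℝ} (hβ : 0 ≤ β)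
    (hO : IsOpen O) (hbot : ∀ x, g x ≠ ⊥) (hfin : ∀ x ∈ O, g x ≠ ⊤)
    (hconv : ConvexOn ℝ O (fun x => (g x).toReal + β / 2 * ‖x‖ ^ 2)) {x v : E} (hx : x ∈ O)
    (hdiff : DifferentiableAt ℝ (fun y => (g y).toReal) x)
    (hv : v ∈ limitingSubdiff g x) : v = gradient (fun y => (g y).toReal) x := by
  -- The quadratic correction has zero derivative at `x`, so Fermat's rule at this minimum
  -- identifies `v` with the gradient.
  have hmin : IsLocalMin (fun y => (g y).toReal - ⟪v, y - x⟫ + β / 2 * ‖y - x‖ ^ 2) x := by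
    filter_upwards [hO.mem_nhds hx] with y hy
    have := weaklyConvex_le_of_limitingSubdiff hβ hO hbot hfin hconv hx hv hy
    simp only [sub_self, inner_zero_right, norm_zero]
    linarith
  have h1 := hdiff.hasGradientAt.hasFDerivAt
  have h2 : HasFDerivAt (fun y : E => y - x) (ContinuousLinearMap.id ℝ E) x :=
    (hasFDerivAt_id x).sub_const x
  have h3 : HasFDerivAt (fun y => ⟪v, y - x⟫) (innerSL ℝ v) x :=
    ((innerSL ℝ v).hasFDerivAt).comp x h2
  have h4 := (h2.norm_sq).const_mul (β / 2)
  have h5 := hmin.hasFDerivAt_eq_zero ((h1.sub h3).add h4)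
  have h6 := DFunLike.congr_fun h5 (gradient (fun y => (g y).toReal) x - v)
  simp only [sub_self, map_zero, ContinuousLinearMap.zero_comp, smul_zero, add_zero,
    zero_apply, sub_apply,
    InnerProductSpace.toDual_apply_apply, innerSL_apply_apply] at h6
  rw [← inner_sub_left] at h6
  exact (sub_eq_zero.1 (inner_self_eq_zero.1 h6)).symm

theorem mem_limitingSubdiff_of_mem_frechetSubdiff {Φ : E → EReal} {z w : E}
    (hw : w ∈ frechetSubdiff Φ z) : w ∈ limitingSubdiff Φ z :=
  ⟨hw.1, hw.2.1, fun _ => z, fun _ => w, tendsto_const_nhds, tendsto_const_nhds,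
    tendsto_const_nhds, fun _ => hw⟩

/-- The gradient of a smooth function that supports `Φ` locally from below at `z` is a Fréchet
subgradient. -/
theorem mem_frechetSubdiff_of_minorant [CompleteSpace E] {Φ : E → EReal} {ψ : E → ℝ} {z w : E}
    {a : ℝ} (ha : Φ z = a) (hψ : HasGradientAt ψ w z)
    (hmin : ∀ᶠ y in 𝓝 z, ((a + (ψ y - ψ z) : ℝ) : EReal) ≤ Φ y) : w ∈ frechetSubdiff Φ z := by
  refine ⟨by simp [ha], by simp [ha], fun ε hε => ?_⟩
  have h := (hasGradientAt_iff_isLittleO.1 hψ).def hε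
  filter_upwards [h, hmin] with y hy hy'
  refine le_trans ?_ hy'
  rw [ha, ← EReal.coe_add, EReal.coe_le_coe_iff]
  rw [Real.norm_eq_abs] at hy
  linarith [(abs_le.1 hy).1]

/-- The descent lemma for functions with Lipschitz continuous gradient. -/
theorem le_add_of_lipschitzWith_gradient [CompleteSpace E] {h : E → ℝ} {ℓ : ℝ≥0}
    (hh : Differentiable ℝ h) (hl : LipschitzWith ℓ (gradient h)) (a b : E) :
    h b ≤ h a + ⟪gradient h a, b - a⟫ + ℓ / 2 * ‖b - a‖ ^ 2 := by
  -- The Lipschitz bound makes the derivative of `p` nonpositive on `(0, 1)`; the claim is `p 1 ≤ p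
  -- 0`.
  let p : ℝ → ℝ := fun t => h (a + t • (b - a)) - t * ⟪gradient h a, b - a⟫
    - ℓ / 2 * t ^ 2 * ‖b - a‖ ^ 2
  have hd : ∀ t, HasDerivAt p (⟪gradient h (a + t • (b - a)), b - a⟫ - ⟪gradient h a, b - a⟫
      - ℓ * t * ‖b - a‖ ^ 2) t := by
    intro t
    have h1 : HasDerivAt (fun t : ℝ => a + t • (b - a)) (b - a) t := by
      simpa using ((hasDerivAt_id t).smul_const (b - a)).const_add a
    have h2 := (hh (a + t • (b - a))).hasGradientAt.hasFDerivAt.comp_hasDerivAt t h1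
    have h3 := (hasDerivAt_id t).mul_const ⟪gradient h a, b - a⟫
    have h4 := ((hasDerivAt_pow 2 t).const_mul ((ℓ : ℝ) / 2)).mul_const (‖b - a‖ ^ 2)
    refine ((h2.sub h3).sub h4).congr_deriv ?_
    simp only [InnerProductSpace.toDual_apply_apply, Nat.cast_ofNat, Nat.add_one_sub_one, pow_one]
    ring
  have hanti : AntitoneOn p (Set.Icc 0 1) := by
    refine antitoneOn_of_deriv_nonpos (convex_Icc 0 1)
      (fun t _ => (hd t).continuousAt.continuousWithinAt)
      (fun t _ => (hd t).differentiableAt.differentiableWithinAt) fun t ht => ?_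
    rw [interior_Icc] at ht
    rw [(hd t).deriv, ← inner_sub_left]
    have h1 := real_inner_le_norm (gradient h (a + t • (b - a)) - gradient h a) (b - a)
    have h2 := hl.dist_le_mul (a + t • (b - a)) a
    rw [dist_eq_norm, dist_eq_norm, add_sub_cancel_left, norm_smul, Real.norm_eq_abs,
      abs_of_pos ht.1] at h2
    have h3 := mul_le_mul_of_nonneg_right h2 (norm_nonneg (b - a))
    linarith
  have h := hanti (Set.left_mem_Icc.2 zero_le_one) (Set.right_mem_Icc.2 zero_le_one) zero_le_one
  simp only [p, zero_smul, add_zero, one_smul, add_sub_cancel] at h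
  linarith

end Subgradients

/-! ### Finite length and decay rates of real recursions -/

section Sequences

/-- The two quarters add up to a weight `1 / 2 < 1`, so half of the sum can be absorbed while the
`Δ`-terms telescope. The bound does not depend on `m`, and the recursion is only needed below `m`;
this is what a trapping induction requires. -/
theorem sum_le_of_recursion {b Δ : ℕ → ℝ} {P : ℝ} (hP : 0 ≤ P) (hb : ∀ n, 0 ≤ b n)
    (hΔ : ∀ n, 0 ≤ Δ n) {N m : ℕ} (hNm : N ≤ m)
    (hrec : ∀ n, N ≤ n → n < m →
      b (n + 2) ≤ P * (Δ (n + 1) - Δ (n + 2)) + (b (n + 1) + b n) / 4) :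
    ∑ n ∈ Finset.Ico N m, b (n + 2) ≤ 2 * P * Δ (N + 1) + b (N + 1) + b N := by
  -- The left side is nonincreasing in `m`: its increment is exactly the defect in the recursion.
  have key : (1 / 2) * ∑ n ∈ Finset.Ico N m, b (n + 2) + P * Δ (m + 1) + b (m + 1) / 2 + b m / 4
      ≤ P * Δ (N + 1) + b (N + 1) / 2 + b N / 4 := by
    induction m, hNm using Nat.le_induction with
    | base => simp
    | succ m hm ih =>
      have h1 := ih fun n h1 h2 => hrec n h1 (by omega)
      have h2 := hrec m hm (by omega)
      rw [Finset.sum_Ico_succ_top hm]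
      simp only [add_assoc, Nat.reduceAdd] at h1 h2 ⊢
      linarith
  have h1 := mul_nonneg hP (hΔ (m + 1))
  linarith [hb (m + 1), hb m, hb N]

/-- A sequence whose steps obey the recursion as long as it stays near a cluster point is trapped
near that point. -/
theorem exists_forall_mem_ball_of_recursion {X : Type*} [SeminormedAddCommGroup X]
    {y : ℕ → X} {a : X} {Δ : ℕ → ℝ} {P ε : ℝ} {N₀ : ℕ} (hP : 0 ≤ P) (hε : 0 < ε)
    (hb : Tendsto (fun n => ‖y (n + 1) - y n‖) atTop (𝓝 0))
    (hΔ : ∀ n, 0 ≤ Δ n) (hΔ0 : Tendsto Δ atTop (𝓝 0)) (hy : MapClusterPt a atTop y)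
    (hrec : ∀ n, N₀ ≤ n → y (n + 1) ∈ Metric.ball a ε → y (n + 2) ∈ Metric.ball a ε →
      ‖y (n + 3) - y (n + 2)‖ ≤ P * (Δ (n + 1) - Δ (n + 2)) +
        (‖y (n + 2) - y (n + 1)‖ + ‖y (n + 1) - y n‖) / 4) :
    ∃ N, N₀ ≤ N ∧ ∀ n, N ≤ n → y (n + 1) ∈ Metric.ball a ε := by
  -- This quantity bounds the remaining path length as long as the recursion holds. Starting within
  -- `ε / 4` of `a`, the first two steps lead to distances below `ε / 2` and `3 * ε / 4`, and the
  -- remaining path uses up less than the last `ε / 4`.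
  have hsmall : ∀ᶠ n in atTop, 2 * P * Δ (n + 1) + ‖y (n + 2) - y (n + 1)‖ + ‖y (n + 1) - y n‖
      < ε / 4 := by
    have h1 : Tendsto (fun n => 2 * P * Δ (n + 1) + ‖y (n + 2) - y (n + 1)‖ + ‖y (n + 1) - y n‖)
        atTop (𝓝 (2 * P * 0 + 0 + 0)) :=
      (((hΔ0.comp (tendsto_add_atTop_nat 1)).const_mul _).add
        (hb.comp (tendsto_add_atTop_nat 1))).add hb
    exact h1.eventually (Iio_mem_nhds (by simp; positivity))
  have hev : ∀ᶠ n in atTop, N₀ ≤ n ∧ 2 * P * Δ (n + 1) + ‖y (n + 2) - y (n + 1)‖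
      + ‖y (n + 1) - y n‖ < ε / 4 := (eventually_ge_atTop N₀).and hsmall
  obtain ⟨N, hN, hN0, hNs⟩ :=
    ((hy.frequently (Metric.ball_mem_nhds a (by positivity : 0 < ε / 4))).and_eventually hev).exists
  rw [dist_eq_norm] at hN
  have hPΔ : 0 ≤ 2 * P * Δ (N + 1) := by have := hΔ (N + 1); positivity
  have h1 : ‖y (N + 1) - a‖ < ε / 2 := by
    have : y (N + 1) - a = (y (N + 1) - y N) + (y N - a) := by abel
    rw [this]
    linarith [norm_add_le (y (N + 1) - y N) (y N - a), norm_nonneg (y (N + 2) - y (N + 1))]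
  have h2 : ‖y (N + 2) - a‖ < 3 * ε / 4 := by
    have : y (N + 2) - a = (y (N + 2) - y (N + 1)) + (y (N + 1) - a) := by abel
    rw [this]
    linarith [norm_add_le (y (N + 2) - y (N + 1)) (y (N + 1) - a), norm_nonneg (y (N + 1) - y N)]
  have key : ∀ m, N ≤ m → ∀ n, N ≤ n → n ≤ m → y (n + 2) ∈ Metric.ball a ε := by
    intro m hm
    induction m, hm using Nat.le_induction with
    | base =>
      intro n h3 h4
      obtain rfl : n = N := by omega
      rw [mem_ball_iff_norm]; linarith
    | succ m hm ih =>
      intro n h3 h4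
      rcases Nat.lt_or_ge n (m + 1) with h5 | h5
      · exact ih n h3 (by omega)
      obtain rfl : n = m + 1 := by omega
      have hsum := sum_le_of_recursion (b := fun n => ‖y (n + 1) - y n‖) hP
        (fun _ => norm_nonneg _) hΔ (show N ≤ m + 1 by omega) fun k hk1 hk2 => by
          refine hrec k (by omega) ?_ (ih k hk1 (by omega))
          rcases Nat.eq_or_lt_of_le hk1 with rfl | hk3
          · rw [mem_ball_iff_norm]; linarith
          · have := ih (k - 1) (by omega) (by omega)
            rwa [show k - 1 + 2 = k + 1 by omega] at this
      have htel : y (m + 1 + 2) - y (N + 2) =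
          ∑ n ∈ Finset.Ico N (m + 1), (y (n + 2 + 1) - y (n + 2)) := by
        rw [Finset.sum_Ico_eq_sub _ (by omega),
          Finset.sum_range_sub (fun n => y (n + 2)), Finset.sum_range_sub (fun n => y (n + 2))]
        abel
      have hle := norm_sum_le (Finset.Ico N (m + 1)) (fun n => y (n + 2 + 1) - y (n + 2))
      rw [← htel] at hle
      rw [mem_ball_iff_norm,
        show y (m + 1 + 2) - a = (y (m + 1 + 2) - y (N + 2)) + (y (N + 2) - a) by abel]
      simp only [add_assoc, Nat.reduceAdd] at hsum hle hNs ⊢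
      linarith [norm_add_le (y (m + 3) - y (N + 2)) (y (N + 2) - a)]
  exact ⟨N + 1, by omega, fun n hn => by
    have := key n (by omega) (n - 1) (by omega) (by omega)
    rwa [show n - 1 + 2 = n + 1 by omega] at this⟩

/-- The recursion makes the steps summable and bounds the distance to the limit. -/
theorem summable_of_recursion {X : Type*} [NormedAddCommGroup X] [CompleteSpace X]
    {y : ℕ → X} {Δ : ℕ → ℝ} {P : ℝ} {N : ℕ} (hP : 0 ≤ P) (hΔ : ∀ n, 0 ≤ Δ n)
    (hrec : ∀ n, N ≤ n → ‖y (n + 3) - y (n + 2)‖ ≤ P * (Δ (n + 1) - Δ (n + 2)) +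
        (‖y (n + 2) - y (n + 1)‖ + ‖y (n + 1) - y n‖) / 4) :
    Summable (fun n => ‖y (n + 1) - y n‖) ∧ ∃ a, Tendsto y atTop (𝓝 a) ∧ ∀ n, N ≤ n →
      ‖y (n + 2) - a‖ ≤ 2 * P * Δ (n + 1) + ‖y (n + 2) - y (n + 1)‖ + ‖y (n + 1) - y n‖ := by
  have hsum : ∀ n m, N ≤ n → n ≤ m → ∑ k ∈ Finset.Ico n m, ‖y (k + 2 + 1) - y (k + 2)‖ ≤
      2 * P * Δ (n + 1) + ‖y (n + 2) - y (n + 1)‖ + ‖y (n + 1) - y n‖ := fun n m hn hm =>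
    sum_le_of_recursion (b := fun n => ‖y (n + 1) - y n‖) hP
        (fun _ => norm_nonneg _) hΔ hm fun k hk1 hk2 => hrec k (by omega)
  have hs : Summable (fun n => ‖y (n + 1) - y n‖) := by
    rw [← summable_nat_add_iff (N + 2)]
    refine summable_of_sum_range_le (c := 2 * P * Δ (N + 1) + ‖y (N + 2) - y (N + 1)‖
      + ‖y (N + 1) - y N‖) (fun _ => norm_nonneg _) fun m => ?_
    refine le_trans (le_of_eq ?_) (hsum N (N + m) le_rfl (by omega))
    rw [Finset.sum_Ico_eq_sum_range]
    simp only [add_tsub_cancel_left]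
    refine Finset.sum_congr rfl fun k _ => ?_
    rw [show k + (N + 2) = N + k + 2 by omega]
  obtain ⟨a, ha⟩ := cauchySeq_tendsto_of_complete (cauchySeq_of_summable_dist (f := y)
    (by simpa only [dist_eq_norm, norm_sub_rev (y _) (y (Nat.succ _)), Nat.succ_eq_add_one] using hs))
  refine ⟨hs, a, ha, fun n hn => ?_⟩
  have hlim : Tendsto (fun m => ‖y (n + 2) - y (m + 2)‖) atTop (𝓝 ‖y (n + 2) - a‖) :=
    (tendsto_const_nhds.sub (ha.comp (tendsto_add_atTop_nat 2))).norm
  refine le_of_tendsto hlim ?_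
  filter_upwards [eventually_ge_atTop n] with m hm
  refine le_trans ?_ (hsum n m hn hm)
  have htel : y (m + 2) - y (n + 2) =
      ∑ k ∈ Finset.Ico n m, (y (k + 2 + 1) - y (k + 2)) := by
    rw [Finset.sum_Ico_eq_sub _ (by omega),
      Finset.sum_range_sub (fun n => y (n + 2)), Finset.sum_range_sub (fun n => y (n + 2))]
    abel
  rw [norm_sub_rev, htel]
  exact norm_sum_le _ _

/-- A bound valid from some index on is valid everywhere after enlarging the constant. -/
theorem exists_forall_le_of_eventually_le {u v : ℕ → ℝ} {γ : ℝ} {N n₀ : ℕ}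
    (hv : ∀ n, n₀ ≤ n → 0 < v n) (h : ∀ n, N ≤ n → u n ≤ γ * v n) :
    ∃ γ' : ℝ, 0 < γ' ∧ ∀ γ'', γ' ≤ γ'' → ∀ n, n₀ ≤ n → u n ≤ γ'' * v n := by
  refine ⟨|γ| + 1 + ∑ k ∈ Finset.range N, |u k / v k|, ?_, fun γ'' hγ n hn => ?_⟩
  · have : 0 ≤ ∑ k ∈ Finset.range N, |u k / v k| := Finset.sum_nonneg fun _ _ => abs_nonneg _
    positivity
  have h0 := hv n hn
  rcases Nat.lt_or_ge n N with h1 | h1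
  · have h2 : |u n / v n| ≤ ∑ k ∈ Finset.range N, |u k / v k| :=
      Finset.single_le_sum (f := fun k => |u k / v k|) (fun _ _ => abs_nonneg _)
        (Finset.mem_range.2 h1)
    have h3 := le_abs_self (u n / v n)
    rw [← div_le_iff₀ h0]
    linarith [abs_nonneg γ]
  · refine (h n h1).trans (mul_le_mul_of_nonneg_right ?_ h0.le)
    have : 0 ≤ ∑ k ∈ Finset.range N, |u k / v k| := Finset.sum_nonneg fun _ _ => abs_nonneg _
    linarith [le_abs_self γ]

/-- Two indices together contract by `K / (1 + K)`, so the rate per index is its square root. The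
constant has one summand for each parity class of starting index, and `+ 1` keeps it positive. -/
theorem exists_geometric_bound {r : ℕ → ℝ} (h0 : ∀ n, 0 ≤ r n) {K : ℝ} (hK : 0 < K)
    {N : ℕ} (hrec : ∀ n, N ≤ n → r (n + 2) ≤ K * (r n - r (n + 2))) :
    ∃ C ρ : ℝ, 0 < C ∧ 0 < ρ ∧ ρ < 1 ∧ ∀ n, N ≤ n → r n ≤ C * ρ ^ n := by
  have hq : 0 < K / (1 + K) := by positivity
  have hq1 : K / (1 + K) < 1 := by rw [div_lt_one (by positivity)]; linarith
  refine ⟨r N / √(K / (1 + K)) ^ N + r (N + 1) / √(K / (1 + K)) ^ (N + 1) + 1,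
    √(K / (1 + K)), ?_, Real.sqrt_pos.2 hq, ?_, ?_⟩
  · have := h0 N; have := h0 (N + 1); positivity
  · rw [Real.sqrt_lt' one_pos]; simpa using hq1
  set ρ := √(K / (1 + K)) with hρ
  have hρ0 : 0 < ρ := Real.sqrt_pos.2 hq
  have hρ2 : ρ ^ 2 = K / (1 + K) := Real.sq_sqrt hq.le
  have ha : 0 ≤ r N / ρ ^ N := div_nonneg (h0 _) (by positivity)
  have hb : 0 ≤ r (N + 1) / ρ ^ (N + 1) := div_nonneg (h0 _) (by positivity)
  intro n hn
  induction n using Nat.strong_induction_on with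
  | _ n ih =>
    rcases Nat.eq_or_lt_of_le hn with rfl | h1
    · rw [← div_le_iff₀ (by positivity)]; linarith
    rcases Nat.eq_or_lt_of_le h1 with rfl | h2
    · rw [← div_le_iff₀ (by positivity)]
      simp only [Nat.succ_eq_add_one]
      linarith
    obtain ⟨k, rfl⟩ : ∃ k, n = k + 2 := ⟨n - 2, by omega⟩
    have h3 := ih k (by omega) (by omega)
    have h4 := hrec k (by omega)
    have h5 : r (k + 2) ≤ ρ ^ 2 * r k := by
      rw [hρ2, div_mul_eq_mul_div, le_div_iff₀ (by positivity)]
      linarith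
    calc r (k + 2) ≤ ρ ^ 2 * r k := h5
      _ ≤ ρ ^ 2 * ((r N / ρ ^ N + r (N + 1) / ρ ^ (N + 1) + 1) * ρ ^ k) := by gcongr
      _ = _ := by ring

/-- With `α = 1 / (q - 1)` one has `α * q = α + 1`. If the bound failed at `k + 2`, the recursion
would force a drop of order `(k + 2) ^ (-α - 1)` from `r k`; for large `C` this exceeds the room
that the inductive bound at `k` leaves. -/
theorem exists_power_bound {r : ℕ → ℝ} (h0 : ∀ n, 0 ≤ r n) (hr : Antitone r) {K q : ℝ}
    (hK : 0 < K) (hq1 : 1 < q) (hq2 : q < 2)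
    {N : ℕ} (hrec : ∀ n, N ≤ n → r (n + 2) ^ q ≤ K * (r n - r (n + 2))) :
    ∃ C : ℝ, 0 < C ∧ ∀ n : ℕ, 1 ≤ n → r n ≤ C * (n : ℝ) ^ (-(1 / (q - 1))) := by
  set α := 1 / (q - 1) with hα
  have hα1 : 1 ≤ α := by rw [hα, le_div_iff₀ (by linarith)]; linarith
  have hα0 : 0 < α := by linarith
  have hαq : α * (q - 1) = 1 := by rw [hα]; field_simp [show q - 1 ≠ 0 by linarith]
  -- The first condition settles `n ≤ N + 2` by monotonicity of `r`; the second makes the forced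
  -- drop large enough in the inductive step.
  obtain ⟨C, hC, hC1, hC2⟩ : ∃ C : ℝ, 0 < C ∧ r 0 * ((N : ℝ) + 2) ^ α ≤ C ∧
      3 * K * 3 ^ α ≤ C ^ (q - 1) := by
    have h1 : 0 < (3 * K * (3 : ℝ) ^ α) ^ α := by positivity
    have h2 := h0 0
    refine ⟨r 0 * ((N : ℝ) + 2) ^ α + (3 * K * (3 : ℝ) ^ α) ^ α, by positivity, by linarith, ?_⟩
    calc 3 * K * (3 : ℝ) ^ α = ((3 * K * (3 : ℝ) ^ α) ^ α) ^ (q - 1) := by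
          rw [← Real.rpow_mul (by positivity), hαq, Real.rpow_one]
      _ ≤ _ := by
          apply Real.rpow_le_rpow h1.le _ (by linarith)
          have : 0 ≤ r 0 * ((N : ℝ) + 2) ^ α := by positivity
          linarith
  refine ⟨C, hC, fun n hn => ?_⟩
  induction n using Nat.strong_induction_on with
  | _ n ih =>
    have hn0 : (0 : ℝ) < n := by exact_mod_cast hn
    rcases Nat.lt_or_ge (N + 2) n with h1 | h1
    swap
    · rw [Real.rpow_neg hn0.le, ← div_eq_mul_inv, le_div_iff₀ (by positivity)]
      refine le_trans ?_ hC1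
      have h2 : (n : ℝ) ≤ N + 2 := by exact_mod_cast h1
      have h3 := hr (Nat.zero_le n)
      have := h0 n
      have := h0 0
      gcongr
    obtain ⟨k, rfl⟩ : ∃ k, n = k + 2 := ⟨n - 2, by omega⟩
    have hk1 : 1 ≤ k := by omega
    have hk0 : (0 : ℝ) < k := by exact_mod_cast hk1
    have h3 := ih k (by omega) hk1
    have h4 := hrec k (by omega)
    by_contra! hlt
    push_cast at hlt
    set t : ℝ := (k : ℝ) + 2 with ht
    have ht0 : 0 < t := by positivity
    have h5 : (C * t ^ (-α)) ^ q ≤ r (k + 2) ^ q :=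
      Real.rpow_le_rpow (by positivity) hlt.le (by linarith)
    have h6 : (C * t ^ (-α)) ^ q = C ^ (q - 1) * C * (t ^ (-α) * t⁻¹) := by
      rw [Real.mul_rpow hC.le (by positivity), ← Real.rpow_mul ht0.le, ← Real.rpow_neg_one t,
        ← Real.rpow_add ht0, show -α * q = -α + -1 by linarith]
      congr 1
      conv_lhs => rw [show q = (q - 1) + 1 by ring]
      rw [Real.rpow_add hC, Real.rpow_one]
    -- Since `t / k = 1 + 2 / k` lies in `[1, 3]`, the convex power lies below its chord over that
    -- interval, and `1 / k ≤ 3 / t`.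
    have h7 : (t / k) ^ α ≤ 1 + 3 * 3 ^ α / t := by
      have hx0 : (0 : ℝ) ≤ 1 / k := by positivity
      have hx1 : (1 : ℝ) / k ≤ 1 := by rw [div_le_one hk0]; exact_mod_cast hk1
      have hc := (convexOn_rpow hα1).2 (show (1 : ℝ) ∈ Set.Ici 0 by simp)
        (show (3 : ℝ) ∈ Set.Ici 0 by simp) (sub_nonneg.2 hx1) hx0 (by ring)
      simp only [smul_eq_mul, mul_one, Real.one_rpow] at hc
      have e : 1 - 1 / (k : ℝ) + 1 / k * 3 = t / k := by rw [ht]; field_simp; ring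
      rw [e] at hc
      have h8 : 1 / (k : ℝ) ≤ 3 / t := by
        rw [div_le_div_iff₀ hk0 ht0, ht]
        have : (1 : ℝ) ≤ k := by exact_mod_cast hk1
        linarith
      have h9 : (1 / (k : ℝ)) * 3 ^ α ≤ 3 / t * 3 ^ α := by gcongr
      calc _ ≤ _ := hc
        _ ≤ 1 + 3 / t * 3 ^ α := by linarith
        _ = _ := by ring
    have h8 : (k : ℝ) ^ (-α) = t ^ (-α) * (t / k) ^ α := by
      rw [Real.div_rpow ht0.le hk0.le, Real.rpow_neg hk0.le, Real.rpow_neg ht0.le]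
      field_simp
    have h9 : C * (k : ℝ) ^ (-α) ≤ C * t ^ (-α) + C ^ (q - 1) * C * (t ^ (-α) * t⁻¹) / K := by
      rw [h8]
      have h10 : 3 * 3 ^ α / t ≤ C ^ (q - 1) / K * t⁻¹ := by
        rw [← div_eq_mul_inv]
        gcongr
        rw [le_div_iff₀ hK]; linarith
      calc C * (t ^ (-α) * (t / k) ^ α) ≤ C * (t ^ (-α) * (1 + C ^ (q - 1) / K * t⁻¹)) := by
            gcongr; linarith
        _ = _ := by ring
    have h11 : C ^ (q - 1) * C * (t ^ (-α) * t⁻¹) / K ≤ r k - r (k + 2) := by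
      rw [div_le_iff₀ hK]
      linarith
    linarith

/-- In the application `u` is the distance to the limit and `w` the objective gap, each controlled
by the merit gap four indices earlier. The delay costs only a fixed power of `ρ`, absorbed by `γ`.
-/
theorem exists_linear_rate {r u w : ℕ → ℝ} (h0 : ∀ n, 0 ≤ r n) {K D : ℝ} (hK : 0 < K) (hD : 0 ≤ D)
    {N : ℕ} (hrec : ∀ n, N ≤ n → r (n + 2) ≤ K * (r n - r (n + 2)))
    (hu : ∀ n, N ≤ n → u (n + 4) ≤ D * √(r n)) (hw : ∀ n, N ≤ n → w (n + 4) ≤ D * r n) :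
    ∃ γ ρ : ℝ, 0 < γ ∧ 0 < ρ ∧ ρ < 1 ∧ (∀ n : ℕ, u n ≤ γ * ρ ^ ((n : ℝ) / 2)) ∧
      ∀ n : ℕ, w n ≤ γ * ρ ^ n := by
  obtain ⟨C, ρ, hC, hρ, hρ1, hr⟩ := exists_geometric_bound h0 hK hrec
  obtain ⟨γ₁, h1, hγ₁⟩ := exists_forall_le_of_eventually_le (u := u)
    (v := fun n => ρ ^ ((n : ℝ) / 2)) (γ := D * √C / ρ ^ (2 : ℝ)) (N := N + 4) (n₀ := 0)
    (fun n _ => by positivity) (fun n hn => by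
      obtain ⟨k, rfl⟩ : ∃ k, n = k + 4 := ⟨n - 4, by omega⟩
      refine (hu k (by omega)).trans ?_
      have h2 : √(r k) ≤ √C * ρ ^ ((k : ℝ) / 2) := by
        calc √(r k) ≤ √(C * ρ ^ k) := Real.sqrt_le_sqrt (hr k (by omega))
          _ = √C * ρ ^ ((k : ℝ) / 2) := by
            rw [Real.sqrt_mul hC.le, Real.sqrt_eq_rpow (ρ ^ k), ← Real.rpow_natCast,
              ← Real.rpow_mul hρ.le]
            ring_nf
      have h3 : ρ ^ (((k + 4 : ℕ) : ℝ) / 2) = ρ ^ ((k : ℝ) / 2) * ρ ^ (2 : ℝ) := by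
        rw [← Real.rpow_add hρ]; push_cast; ring_nf
      rw [h3]
      calc D * √(r k) ≤ D * (√C * ρ ^ ((k : ℝ) / 2)) := by gcongr
        _ = _ := by field_simp)
  obtain ⟨γ₂, h2, hγ₂⟩ := exists_forall_le_of_eventually_le (u := w)
    (v := fun n => ρ ^ n) (γ := D * C / ρ ^ 4) (N := N + 4) (n₀ := 0)
    (fun n _ => by positivity) (fun n hn => by
      obtain ⟨k, rfl⟩ : ∃ k, n = k + 4 := ⟨n - 4, by omega⟩
      refine (hw k (by omega)).trans ?_
      have h2 := hr k (by omega)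
      calc D * r k ≤ D * (C * ρ ^ k) := by gcongr
        _ = _ := by rw [pow_add]; field_simp)
  exact ⟨γ₁ + γ₂, ρ, by positivity, hρ, hρ1, fun n => hγ₁ _ (by linarith) n (Nat.zero_le n),
    fun n => hγ₂ _ (by linarith) n (Nat.zero_le n)⟩

theorem exists_sublinear_rate {r u w : ℕ → ℝ} (h0 : ∀ n, 0 ≤ r n) (hr : Antitone r)
    {K D θ : ℝ} (hK : 0 < K) (hD : 0 ≤ D) (hθ : 1 / 2 < θ) (hθ1 : θ < 1)
    {N : ℕ} (hrec : ∀ n, N ≤ n → r (n + 2) ^ (2 * θ) ≤ K * (r n - r (n + 2)))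
    (hu : ∀ n, N ≤ n → u (n + 4) ≤ D * r n ^ (1 - θ))
    (hw : ∀ n, N ≤ n → w (n + 4) ≤ D * r n ^ (2 - 2 * θ)) :
    ∃ γ : ℝ, 0 < γ ∧ ∀ n : ℕ, 1 ≤ n → u n ≤ γ * (n : ℝ) ^ (-((1 - θ) / (2 * θ - 1))) ∧
      w n ≤ γ * (n : ℝ) ^ (-((2 - 2 * θ) / (2 * θ - 1))) := by
  obtain ⟨C, hC, hrC⟩ := exists_power_bound h0 hr hK (by linarith) (by linarith) hrec
  have key : ∀ (v : ℕ → ℝ) (p : ℝ), 0 ≤ p → (∀ n, N ≤ n → v (n + 4) ≤ D * r n ^ p) →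
      ∃ γ' : ℝ, 0 < γ' ∧ ∀ γ'', γ' ≤ γ'' → ∀ n, 1 ≤ n →
        v n ≤ γ'' * (n : ℝ) ^ (-(p / (2 * θ - 1))) := by
    intro v p hp hv
    have hs : 0 ≤ p / (2 * θ - 1) := div_nonneg hp (by linarith)
    refine exists_forall_le_of_eventually_le (γ := D * (C ^ p * 5 ^ (p / (2 * θ - 1))))
      (N := N + 5) (fun n hn => ?_) fun n hn => ?_
    · have : (0 : ℝ) < n := by exact_mod_cast hn
      positivity
    obtain ⟨k, rfl⟩ : ∃ k, n = k + 4 := ⟨n - 4, by omega⟩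
    have hk : (1 : ℝ) ≤ k := by exact_mod_cast (show 1 ≤ k by omega)
    have hk0 : (0 : ℝ) < k := by linarith
    refine (hv k (by omega)).trans ?_
    have h1 : r k ^ p ≤ C ^ p * (k : ℝ) ^ (-(p / (2 * θ - 1))) := by
      calc r k ^ p ≤ (C * (k : ℝ) ^ (-(1 / (2 * θ - 1)))) ^ p :=
            Real.rpow_le_rpow (h0 k) (hrC k (by omega)) hp
        _ = _ := by
            rw [Real.mul_rpow hC.le (by positivity), ← Real.rpow_mul hk0.le]
            congr 2
            ring
    have h2 : (k : ℝ) ^ (-(p / (2 * θ - 1))) ≤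
        5 ^ (p / (2 * θ - 1)) * ((k + 4 : ℕ) : ℝ) ^ (-(p / (2 * θ - 1))) := by
      -- The delay of four costs a factor `5` inside the power; this needs `k ≥ 1`, whence the
      -- threshold `N + 5`.
      have h3 : ((k + 4 : ℕ) : ℝ) ≤ 5 * k := by push_cast; linarith
      have h4 : (0 : ℝ) < ((k + 4 : ℕ) : ℝ) := by positivity
      have h5 := Real.rpow_le_rpow h4.le h3 hs
      rw [Real.mul_rpow (by norm_num) hk0.le] at h5
      rw [Real.rpow_neg hk0.le, Real.rpow_neg h4.le, ← div_eq_mul_inv, inv_eq_one_div,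
        div_le_div_iff₀ (by positivity) (by positivity)]
      linarith
    calc D * r k ^ p ≤ D * (C ^ p * (5 ^ (p / (2 * θ - 1)) *
          ((k + 4 : ℕ) : ℝ) ^ (-(p / (2 * θ - 1))))) := by
          gcongr
          exact h1.trans (by gcongr)
      _ = _ := by ring
  obtain ⟨γ₁, h1, hγ₁⟩ := key u (1 - θ) (by linarith) hu
  obtain ⟨γ₂, h2, hγ₂⟩ := key w (2 - 2 * θ) (by linarith) hw
  exact ⟨γ₁ + γ₂, by positivity, fun n hn =>
    ⟨hγ₁ _ (by linarith) n hn, hγ₂ _ (by linarith) n hn⟩⟩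

end Sequences

/-! ### Descent sequences under the KL inequality -/

section KL

/-- Puts the KL inequality into usable real form: `η` is shrunk to a real number, concavity becomes
a tangent inequality for `φ`, and the distance to the subdifferential is replaced by the norm of an
arbitrary subgradient. -/
theorem KLInequality.exists_real {E : Type*} [NormedAddCommGroup E] [InnerProductSpace ℝ E]
    {G : E → EReal} {z : E} {φ : ℝ → ℝ} (h : KLInequality G z φ) {a : ℝ} (ha : G z = a) :
    ∃ V ∈ 𝓝 z, ∃ η : ℝ, 0 < η ∧ (∀ t, 0 ≤ t → t < η → 0 ≤ φ t) ∧
      Tendsto φ (𝓝[≥] 0) (𝓝 0) ∧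
      (∀ r t, 0 ≤ t → t ≤ r → 0 < r → r < η → deriv φ r * (r - t) ≤ φ r - φ t) ∧
      ∀ y ∈ V, ∀ b : ℝ, G y = b → a < b → b < a + η → 0 < deriv φ (b - a) ∧
        ∀ w ∈ limitingSubdiff G y, 1 ≤ deriv φ (b - a) * ‖w‖ := by
  obtain ⟨η, hη, V, hV, hcont, hconc, hnn, hC1, hpos, hφ0, hineq⟩ := h
  obtain ⟨η', hη', hlt⟩ : ∃ η' : ℝ, 0 < η' ∧ (η' : EReal) ≤ η := by
    obtain ⟨q, hq0, hq⟩ := EReal.lt_iff_exists_real_btwn.1 hη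
    exact ⟨q, by exact_mod_cast hq0, hq.le⟩
  have hmem : ∀ t : ℝ, t < η' → (t : EReal) < η := fun t ht =>
    lt_of_lt_of_le (EReal.coe_lt_coe_iff.2 ht) hlt
  refine ⟨V, hV, η', hη', fun t h0 h1 => hnn t h0 (hmem t h1), ?_, ?_, ?_⟩
  · have h1 := hcont 0 ⟨le_rfl, hmem 0 hη'⟩
    rw [ContinuousWithinAt, hφ0] at h1
    refine h1.mono_left ?_
    rw [nhdsWithin_le_iff]
    filter_upwards [self_mem_nhdsWithin, nhdsWithin_le_nhds (Iio_mem_nhds hη')] with t h2 h3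
    exact ⟨h2, hmem t h3⟩
  · intro r t ht htr hr hrη
    rcases htr.eq_or_lt with rfl | htr
    · simp
    have hopen : Set.Ioo 0 η' ∈ 𝓝 r := Ioo_mem_nhds hr hrη
    have hd : DifferentiableAt ℝ φ r := by
      refine (hC1.differentiableOn one_ne_zero).differentiableAt ?_
      filter_upwards [hopen] with s hs
      exact ⟨hs.1, hmem s hs.2⟩
    have h1 := hconc.deriv_le_slope (x := t) (y := r) ⟨ht, hmem t (htr.trans hrη)⟩
      ⟨hr.le, hmem r hrη⟩ htr hd
    rwa [slope_def_field, le_div_iff₀ (sub_pos.2 htr)] at h1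
  · intro y hy b hb hab hbη
    have hp := hpos (b - a) (by linarith) (hmem _ (by linarith))
    refine ⟨hp, fun w hw => ?_⟩
    have h1 := hineq y hy (by rw [ha, hb]; exact_mod_cast hab) (by
      rw [ha, hb]
      refine lt_of_lt_of_le (EReal.coe_lt_coe_iff.2 hbη) ?_
      rw [EReal.coe_add]
      gcongr)
    rw [ha, hb, ← EReal.coe_sub, EReal.toReal_coe] at h1
    have h2 := Metric.infEDist_le_edist_of_mem (x := (0 : E)) hw
    rw [edist_dist, dist_zero_left] at h2
    have h3 := h1.trans (mul_le_mul_right h2 _)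
    rw [← ENNReal.ofReal_mul hp.le] at h3
    exact ENNReal.one_le_ofReal.1 h3

theorem deriv_mul_rpow (κ θ : ℝ) {t : ℝ} (ht : 0 < t) :
    deriv (fun t : ℝ => κ * t ^ (1 - θ)) t = κ * ((1 - θ) * t ^ (-θ)) := by
  have := ((Real.hasDerivAt_rpow_const (p := 1 - θ) (Or.inl ht.ne')).const_mul κ).deriv
  rw [this]
  congr 3
  ring

variable {H : Type*} [NormedAddCommGroup H] [InnerProductSpace ℝ H]

/-- `y` is a sequence along which `G (y (n + 1), y n) = e n` decreases to `G (a, a) = v`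
sufficiently fast, with subgradients controlled by the steps. -/
structure IsDescentSequence (G : WithLp 2 (H × H) → EReal) (δ M : ℝ) (y : ℕ → H) (e : ℕ → ℝ)
    (a : H) (v : ℝ) : Prop where
  delta_pos : 0 < δ
  bound_pos : 0 < M
  value : ∀ n, G (WithLp.toLp 2 (y (n + 1), y n)) = e n
  descent : ∀ n, e (n + 1) + δ * ‖y (n + 2) - y (n + 1)‖ ^ 2 ≤ e n
  subgrad : ∀ n, ∃ w ∈ limitingSubdiff G (WithLp.toLp 2 (y (n + 2), y (n + 1))),
    ‖w‖ ≤ M * (‖y (n + 2) - y (n + 1)‖ + ‖y (n + 1) - y n‖)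
  limit_value : G (WithLp.toLp 2 (a, a)) = v
  tendsto_value : Tendsto e atTop (𝓝 v)

namespace IsDescentSequence

variable {G : WithLp 2 (H × H) → EReal} {δ M : ℝ} {y : ℕ → H} {e : ℕ → ℝ} {a : H} {v : ℝ}

theorem antitone (hd : IsDescentSequence G δ M y e a v) : Antitone e :=
  antitone_nat_of_succ_le fun n => by
    have := hd.descent n
    have := hd.delta_pos
    have : 0 ≤ δ * ‖y (n + 2) - y (n + 1)‖ ^ 2 := by positivity
    linarith

theorem le_value (hd : IsDescentSequence G δ M y e a v) (n : ℕ) : v ≤ e n :=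
  hd.antitone.le_of_tendsto hd.tendsto_value n

theorem tendsto_gap (hd : IsDescentSequence G δ M y e a v) :
    Tendsto (fun n => e n - v) atTop (𝓝 0) := by
  simpa using hd.tendsto_value.sub_const v

theorem sq_step_le (hd : IsDescentSequence G δ M y e a v) (n : ℕ) :
    ‖y (n + 2) - y (n + 1)‖ ^ 2 ≤ (e n - e (n + 1)) / δ := by
  rw [le_div_iff₀ hd.delta_pos]
  linarith [hd.descent n]

theorem tendsto_step (hd : IsDescentSequence G δ M y e a v) :
    Tendsto (fun n => ‖y (n + 1) - y n‖) atTop (𝓝 0) := by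
  rw [← tendsto_add_atTop_iff_nat 1]
  have h1 : Tendsto (fun n => (e n - e (n + 1)) / δ) atTop (𝓝 0) := by
    simpa using (hd.tendsto_value.sub
      (hd.tendsto_value.comp (tendsto_add_atTop_nat 1))).div_const δ
  have h2 : Tendsto (fun n => ‖y (n + 1 + 1) - y (n + 1)‖ ^ 2) atTop (𝓝 0) :=
    squeeze_zero (fun _ => by positivity) hd.sq_step_le h1
  have h3 := (Real.continuous_sqrt.tendsto 0).comp h2
  simpa [Function.comp_def, Real.sqrt_sq] using h3

/-- The consequences of the KL inequality for a descent sequence near the limit point. -/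
theorem exists_recursion (hd : IsDescentSequence G δ M y e a v) {φ : ℝ → ℝ}
    (hKL : KLInequality G (WithLp.toLp 2 (a, a)) φ) :
    Tendsto (fun n => |φ (e n - v)|) atTop (𝓝 0) ∧
    ∃ ε > 0, ∃ N, ∀ n, N ≤ n → y (n + 1) ∈ Metric.ball a ε → y (n + 2) ∈ Metric.ball a ε →
      (v < e (n + 1) → 1 ≤ deriv φ (e (n + 1) - v) *
        (M * (‖y (n + 2) - y (n + 1)‖ + ‖y (n + 1) - y n‖))) ∧
      ‖y (n + 3) - y (n + 2)‖ ≤ M / δ * (|φ (e (n + 1) - v)| - |φ (e (n + 2) - v)|) +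
        (‖y (n + 2) - y (n + 1)‖ + ‖y (n + 1) - y n‖) / 4 := by
  obtain ⟨V, hV, η, hη, hnn, hφ, hconc, hineq⟩ := hKL.exists_real hd.limit_value
  have hδ := hd.delta_pos
  have hM := hd.bound_pos
  have hgap : Tendsto (fun n => e n - v) atTop (𝓝[≥] 0) :=
    tendsto_nhdsWithin_iff.2 ⟨hd.tendsto_gap, Eventually.of_forall fun n =>
      sub_nonneg.2 (hd.le_value n)⟩
  refine ⟨by simpa using (hφ.comp hgap).abs, ?_⟩
  have hcont : Continuous (fun p : H × H => (WithLp.toLp 2 p : WithLp 2 (H × H))) :=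
    WithLp.prod_continuous_toLp 2 H H
  obtain ⟨ε, hε, hball⟩ := Metric.mem_nhds_iff.1 (hcont.continuousAt.preimage_mem_nhds hV)
  rw [← ball_prod_same] at hball
  obtain ⟨N, hN⟩ := eventually_atTop.1 (hd.tendsto_gap.eventually (Iio_mem_nhds hη))
  refine ⟨ε, hε, N, fun n hn h1 h2 => ?_⟩
  have hzV : WithLp.toLp 2 (y (n + 2), y (n + 1)) ∈ V := hball ⟨h2, h1⟩
  have hr1 : e (n + 1) - v < η := hN (n + 1) (by omega)
  have hr2 : e (n + 2) - v < η := hN (n + 2) (by omega)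
  have hp1 := sub_nonneg.2 (hd.le_value (n + 1))
  have hp2 := sub_nonneg.2 (hd.le_value (n + 2))
  obtain ⟨w, hw, hwM⟩ := hd.subgrad n
  have hfirst : v < e (n + 1) → 0 < deriv φ (e (n + 1) - v) ∧ 1 ≤ deriv φ (e (n + 1) - v) *
        (M * (‖y (n + 2) - y (n + 1)‖ + ‖y (n + 1) - y n‖)) := by
    intro hlt
    obtain ⟨hpos, h3⟩ := hineq _ hzV _ (hd.value (n + 1)) hlt (by linarith)
    exact ⟨hpos, (h3 w hw).trans (mul_le_mul_of_nonneg_left hwM hpos.le)⟩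
  refine ⟨fun hlt => (hfirst hlt).2, ?_⟩
  -- `φ` is known to be nonnegative only on `[0, η)`. The absolute values make the sequence
  -- nonnegative at every index and change nothing here.
  rw [abs_of_nonneg (hnn _ hp1 hr1), abs_of_nonneg (hnn _ hp2 hr2)]
  have hsq := hd.sq_step_le (n + 1)
  have hanti := hd.antitone (show n + 1 ≤ n + 2 by omega)
  set S := ‖y (n + 2) - y (n + 1)‖ + ‖y (n + 1) - y n‖ with hS
  have hS0 : 0 ≤ S := by positivity
  rcases (hd.le_value (n + 1)).eq_or_lt with heq | hlt
  · have h3 : e (n + 2) = e (n + 1) := le_antisymm hanti (heq ▸ hd.le_value (n + 2))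
    have h4 : ‖y (n + 3) - y (n + 2)‖ ^ 2 ≤ 0 := by
      refine hsq.trans (le_of_eq ?_)
      rw [show n + 1 + 1 = n + 2 from rfl, h3]; simp
    have h5 : ‖y (n + 3) - y (n + 2)‖ = 0 := by
      have := sq_nonneg ‖y (n + 3) - y (n + 2)‖
      exact pow_eq_zero_iff (two_ne_zero) |>.1 (le_antisymm h4 this)
    rw [h5, h3]
    simp only [sub_self, mul_zero, zero_add]
    positivity
  · obtain ⟨hpos, h3⟩ := hfirst hlt
    have h4 := hconc (e (n + 1) - v) (e (n + 2) - v) hp2 (by linarith) (by linarith) hr1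
    have hR : 0 ≤ e (n + 1) - e (n + 2) := by linarith
    set Φ := φ (e (n + 1) - v) - φ (e (n + 2) - v)
    -- The tangent inequality bounds `φ'` times the decrease by `Φ`, and the KL inequality bounds `1
    -- / φ'` by `M * S`.
    have h5 : e (n + 1) - e (n + 2) ≤ Φ * (M * S) := by
      calc e (n + 1) - e (n + 2)
          ≤ (e (n + 1) - e (n + 2)) * (deriv φ (e (n + 1) - v) * (M * S)) :=
            le_mul_of_one_le_right hR h3
        _ = (deriv φ (e (n + 1) - v) * (e (n + 1) - v - (e (n + 2) - v))) * (M * S) := by ring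
        _ ≤ Φ * (M * S) := by gcongr
    have hΦ : 0 ≤ Φ := by
      refine le_trans ?_ h4
      have : 0 ≤ e (n + 1) - v - (e (n + 2) - v) := by linarith
      positivity
    have hp : 0 ≤ M / δ * Φ := by positivity
    refine abs_le_of_sq_le_sq' (a := ‖y (n + 3) - y (n + 2)‖) ?_ (by positivity) |>.2
    calc ‖y (n + 3) - y (n + 2)‖ ^ 2 ≤ (e (n + 1) - e (n + 2)) / δ := hsq
      _ ≤ Φ * (M * S) / δ := by gcongr
      _ = (M / δ * Φ) * S := by ring
      -- Arithmetic–geometric mean with weights chosen so that `S` gets the coefficient `1 / 4`.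
      _ ≤ (M / δ * Φ + S / 4) ^ 2 := by linarith [sq_nonneg (M / δ * Φ - S / 4)]

/-- The KL inequality holds only near `(a, a)`, so trapping comes first. Then the recursion holds at
all large indices, the sequence has finite length, and its limit must be the cluster point. -/
theorem tendsto_of_mapClusterPt [CompleteSpace H] (hd : IsDescentSequence G δ M y e a v)
    (hcl : MapClusterPt a atTop y) (hKL : KLProperty G (WithLp.toLp 2 (a, a))) :
    Tendsto y atTop (𝓝 a) ∧ Summable (fun n => ‖y (n + 1) - y n‖) := by
  obtain ⟨φ, hφ⟩ := hKL
  obtain ⟨hΔ, ε, hε, N, hrec⟩ := hd.exists_recursion hφ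
  have hP : 0 ≤ M / δ := div_nonneg hd.bound_pos.le hd.delta_pos.le
  obtain ⟨N', hN', hball⟩ := exists_forall_mem_ball_of_recursion hP hε hd.tendsto_step
    (fun _ => abs_nonneg _) hΔ hcl fun n hn h1 h2 => (hrec n hn h1 h2).2
  obtain ⟨hs, b, hb, -⟩ := summable_of_recursion hP (Δ := fun n => |φ (e n - v)|)
    (fun _ => abs_nonneg _) (N := N')
    fun n hn => (hrec n (hN'.trans hn) (hball n hn) (hball (n + 1) (by omega))).2
  obtain rfl : a = b := by
    have h1 : ClusterPt a (map y atTop) := hcl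
    exact eq_of_nhds_neBot (h1.neBot.mono (inf_le_inf_left _ hb))
  exact ⟨hb, hs⟩

/-- Rate estimates for a convergent descent sequence under a KL exponent. -/
theorem exists_estimates [CompleteSpace H] (hd : IsDescentSequence G δ M y e a v)
    (hy : Tendsto y atTop (𝓝 a)) {θ : ℝ} (hθ1 : θ < 1)
    (hKL : KLPropertyWithExponent G (WithLp.toLp 2 (a, a)) θ) :
    ∃ L > 0, ∃ N, (∀ n, N ≤ n → v < e (n + 1) →
        (e (n + 1) - v) ^ θ ≤ L * (‖y (n + 2) - y (n + 1)‖ + ‖y (n + 1) - y n‖)) ∧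
      ∀ n, N ≤ n → e n - v ≤ 1 ∧
        ‖y (n + 3) - a‖ ≤ L * ((e n - v) ^ (1 - θ) + √(e n - v)) := by
  obtain ⟨κ, hκ, hφ⟩ := hKL
  obtain ⟨hΔ, ε, hε, N, hrec⟩ := hd.exists_recursion hφ
  have hδ := hd.delta_pos
  have hM := hd.bound_pos
  have hP : 0 ≤ M / δ := by positivity
  have hball : ∀ᶠ n in atTop, y n ∈ Metric.ball a ε := hy.eventually (Metric.ball_mem_nhds a hε)
  obtain ⟨N₁, hN₁⟩ := eventually_atTop.1 hball
  obtain ⟨N₂, hN₂⟩ := eventually_atTop.1 (hd.tendsto_gap.eventually (Iio_mem_nhds one_pos))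
  have hrec' := fun n (hn : N + N₁ + N₂ ≤ n) =>
    hrec n (by omega) (hN₁ (n + 1) (by omega)) (hN₁ (n + 2) (by omega))
  obtain ⟨-, b, hb, hbound⟩ := summable_of_recursion hP
    (Δ := fun n => |κ * (e n - v) ^ (1 - θ)|) (fun _ => abs_nonneg _) (N := N + N₁ + N₂)
    fun n hn => (hrec' n hn).2
  obtain rfl : a = b := tendsto_nhds_unique hy hb
  have h1θ : 0 < 1 - θ := by linarith
  have hL1 : 0 < κ * (1 - θ) * M := by positivity
  have hL2 : 0 < 2 * (M / δ) * κ + 2 / √δ := by positivity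
  refine ⟨κ * (1 - θ) * M + (2 * (M / δ) * κ + 2 / √δ), by positivity, N + N₁ + N₂,
    fun n hn hlt => ?_, fun n hn => ⟨(hN₂ n (by omega)).le, ?_⟩⟩
  · have h1 := (hrec' n hn).1 hlt
    have ht : 0 < e (n + 1) - v := sub_pos.2 hlt
    rw [deriv_mul_rpow _ _ ht, Real.rpow_neg ht.le] at h1
    have h2 : 0 < (e (n + 1) - v) ^ θ := by positivity
    have h3 := mul_le_mul_of_nonneg_right h1 h2.le
    rw [one_mul] at h3
    refine h3.trans ?_
    have h4 : 0 ≤ ‖y (n + 2) - y (n + 1)‖ + ‖y (n + 1) - y n‖ := by positivity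
    calc _ = κ * (1 - θ) * M * (‖y (n + 2) - y (n + 1)‖ + ‖y (n + 1) - y n‖) := by
          field_simp
      _ ≤ _ := by gcongr; linarith
  · have hg := sub_nonneg.2 (hd.le_value n)
    -- Every later squared step is paid for by the gap still available at index `n`.
    have hstep : ∀ k, n ≤ k → ‖y (k + 2) - y (k + 1)‖ ≤ √(e n - v) / √δ := by
      intro k hk
      rw [← Real.sqrt_div hg]
      refine Real.le_sqrt_of_sq_le ((hd.sq_step_le k).trans ?_)
      gcongr
      · exact hd.antitone hk
      · exact hd.le_value _
    have h1 := hbound (n + 1) (by omega)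
    have h2 := hstep n le_rfl
    have h3 := hstep (n + 1) (by omega)
    simp only [add_assoc, Nat.reduceAdd] at h1 h2 h3
    have hg2 := sub_nonneg.2 (hd.le_value (n + 2))
    have h4 : |κ * (e (n + 2) - v) ^ (1 - θ)| ≤ κ * (e n - v) ^ (1 - θ) := by
      rw [abs_of_nonneg (by positivity)]
      have := hd.antitone (show n ≤ n + 2 by omega)
      gcongr
    have h5 : 2 * (M / δ) * |κ * (e (n + 2) - v) ^ (1 - θ)| ≤
        2 * (M / δ) * κ * (e n - v) ^ (1 - θ) := by
      rw [mul_assoc (2 * (M / δ))]; gcongr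
    set p := (e n - v) ^ (1 - θ)
    have hp : 0 ≤ p := by positivity
    set q := √(e n - v)
    have hq : 0 ≤ q := Real.sqrt_nonneg _
    have h6 : 0 ≤ 2 * (M / δ) * κ * q := by positivity
    have h7 : 0 ≤ 2 / √δ * p := by positivity
    have h8 : 0 ≤ κ * (1 - θ) * M * (p + q) := by positivity
    have h9 : 2 * (q / √δ) = 2 / √δ * q := by ring
    linarith

/-- For `θ = 0` the KL estimate reads `1 ≤ L * (sum of two steps)` wherever the gap is positive. The
steps tend to `0`, so the gap vanishes from some index on, and a zero decrease forces zero steps. -/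
theorem eventually_eq_of_exponent_zero [CompleteSpace H] (hd : IsDescentSequence G δ M y e a v)
    (hy : Tendsto y atTop (𝓝 a)) (hKL : KLPropertyWithExponent G (WithLp.toLp 2 (a, a)) 0) :
    ∃ N, ∀ n, N ≤ n → y n = a := by
  obtain ⟨L, hL, N, hrec, -⟩ := hd.exists_estimates hy one_pos hKL
  have h0 : Tendsto (fun n => L * (‖y (n + 2) - y (n + 1)‖ + ‖y (n + 1) - y n‖)) atTop
      (𝓝 (L * (0 + 0))) :=
    ((hd.tendsto_step.comp (tendsto_add_atTop_nat 1)).add hd.tendsto_step).const_mul L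
  obtain ⟨N₁, hN₁⟩ := eventually_atTop.1
    (h0.eventually (Iio_mem_nhds (by simp : L * (0 + 0) < 1)))
  have hz : ∀ n, N + N₁ ≤ n → e (n + 1) = v := by
    intro n hn
    by_contra hne
    have h1 := hrec n (by omega) (lt_of_le_of_ne (hd.le_value _) (Ne.symm hne))
    rw [Real.rpow_zero] at h1
    exact absurd (hN₁ n (by omega)) (not_lt.2 h1)
  have hconst : ∀ n, N + N₁ + 3 ≤ n → y n = y (N + N₁ + 3) := by
    intro n hn
    induction n, hn using Nat.le_induction with
    | base => rfl
    | succ n hn ih =>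
      obtain ⟨k, rfl⟩ : ∃ k, n = k + 2 := ⟨n - 2, by omega⟩
      have h1 := hd.sq_step_le (k + 1)
      rw [hz k (by omega), hz (k + 1) (by omega), sub_self, zero_div] at h1
      have h2 : ‖y (k + 1 + 2) - y (k + 1 + 1)‖ = 0 :=
        pow_eq_zero_iff two_ne_zero |>.1 (le_antisymm h1 (sq_nonneg _))
      rw [← ih]
      exact sub_eq_zero.1 (norm_eq_zero.1 h2)
  refine ⟨N + N₁ + 3, fun n hn => ?_⟩
  rw [hconst n hn]
  refine tendsto_nhds_unique (tendsto_const_nhds.congr' ?_) hy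
  filter_upwards [eventually_ge_atTop (N + N₁ + 3)] with k hk
  exact (hconst k hk).symm

/-- Squaring the KL estimate bounds the gap to the power `2 * θ` by two consecutive squared steps,
hence by the decrease over two indices. Removing `c` times a squared step from the merit gap leaves
the objective gap, so that is linear in the merit gap as well. -/
theorem exists_gap_recursion [CompleteSpace H] (hd : IsDescentSequence G δ M y e a v)
    (hy : Tendsto y atTop (𝓝 a)) {θ : ℝ} (hθ0 : 0 < θ) (hθ1 : θ < 1)
    (hKL : KLPropertyWithExponent G (WithLp.toLp 2 (a, a)) θ) {c : ℝ} (hc : 0 ≤ c) :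
    ∃ K > 0, ∃ D ≥ 0, ∃ N, ∀ n, N ≤ n →
      (e (n + 2) - v) ^ (2 * θ) ≤ K * (e n - v - (e (n + 2) - v)) ∧
      e n - v ≤ 1 ∧
      ‖y (n + 3) - a‖ ≤ D * ((e n - v) ^ (1 - θ) + √(e n - v)) ∧
      |e (n + 2) - v - c * ‖y (n + 3) - y (n + 2)‖ ^ 2| ≤ D * (e n - v) := by
  obtain ⟨L, hL, N, hrec, hest⟩ := hd.exists_estimates hy hθ1 hKL
  have hδ := hd.delta_pos
  refine ⟨2 * L ^ 2 / δ, by positivity, L + (1 + c / δ), by positivity, N, fun n hn =>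
    ⟨?_, (hest n hn).1, (hest n hn).2.trans ?_, ?_⟩⟩
  · have hR : 0 ≤ e n - v - (e (n + 2) - v) := by
      have := hd.antitone (show n ≤ n + 2 by omega); linarith
    rcases (hd.le_value (n + 2)).eq_or_lt with heq | hlt
    · rw [← heq, sub_self, Real.zero_rpow (by positivity)]
      rw [← heq, sub_self] at hR
      positivity
    have h1 := hrec (n + 1) (by omega) hlt
    have h2 := hd.sq_step_le n
    have h3 := hd.sq_step_le (n + 1)
    simp only [add_assoc, Nat.reduceAdd] at h1 h2 h3
    have h4 : 0 ≤ (e (n + 2) - v) ^ θ := by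
      have := sub_nonneg.2 (hd.le_value (n + 2)); positivity
    have h5 := pow_le_pow_left₀ h4 h1 2
    rw [← Real.rpow_mul_natCast (sub_nonneg.2 (hd.le_value (n + 2)))] at h5
    rw [show 2 * θ = θ * ((2 : ℕ) : ℝ) by push_cast; ring]
    refine h5.trans ?_
    set p := ‖y (n + 3) - y (n + 2)‖
    set q := ‖y (n + 2) - y (n + 1)‖
    calc (L * (p + q)) ^ 2 ≤ 2 * L ^ 2 * (p ^ 2 + q ^ 2) := by
          nlinarith [mul_nonneg (sq_nonneg L) (sq_nonneg (p - q))]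
      _ ≤ 2 * L ^ 2 * ((e (n + 1) - e (n + 2)) / δ + (e n - e (n + 1)) / δ) := by gcongr
      _ = _ := by ring
  · have := sub_nonneg.2 (hd.le_value n)
    have hcδ : 0 ≤ c / δ := by positivity
    gcongr
    linarith
  · have hg := sub_nonneg.2 (hd.le_value n)
    have hg2 := sub_nonneg.2 (hd.le_value (n + 2))
    have h3 := hd.sq_step_le (n + 1)
    simp only [add_assoc, Nat.reduceAdd] at h3
    have ha1 := hd.antitone (show n ≤ n + 1 by omega)
    have ha2 := hd.antitone (show n ≤ n + 2 by omega)
    have h4 : c * ‖y (n + 3) - y (n + 2)‖ ^ 2 ≤ c / δ * (e n - v) := by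
      calc c * ‖y (n + 3) - y (n + 2)‖ ^ 2 ≤ c * ((e (n + 1) - e (n + 2)) / δ) := by gcongr
        _ ≤ c * ((e n - v) / δ) := by gcongr; linarith
        _ = _ := by ring
    have h5 : 0 ≤ c * ‖y (n + 3) - y (n + 2)‖ ^ 2 := by positivity
    have h6 : 0 ≤ L * (e n - v) := by positivity
    have h7 : 0 ≤ c / δ * (e n - v) := by positivity
    rw [abs_le]
    constructor <;> linarith

end IsDescentSequence

end KL

/-! ### Optimality and decrease for one proximal step -/

section Objective

variable {H K : Type*} [NormedAddCommGroup H] [InnerProductSpace ℝ H]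
  [NormedAddCommGroup K] [InnerProductSpace ℝ K]

/-- The real value of the objective function where it is finite. -/
def realObjective (f : H → EReal) (h : K → ℝ) (A : H →L[ℝ] K) (g : H → EReal) (x : H) : ℝ :=
  (f x).toReal + h (A x) - (g x).toReal

theorem objective_eq_coe {f : H → EReal} {h : K → ℝ} {A : H →L[ℝ] K} {g : H → EReal} {x : H}
    (hfb : f x ≠ ⊥) (hft : f x ≠ ⊤) (hgb : g x ≠ ⊥) (hgt : g x ≠ ⊤) :
    objective f h A g x = (realObjective f h A g x : ℝ) := by
  rw [objective, realObjective, EReal.coe_sub, EReal.coe_add, EReal.coe_toReal hft hfb,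
    EReal.coe_toReal hgt hgb]

theorem objective_eq_top {f : H → EReal} {h : K → ℝ} {A : H →L[ℝ] K} {g : H → EReal} {x : H}
    (hf : f x = ⊤) (hgb : g x ≠ ⊥) (hgt : g x ≠ ⊤) : objective f h A g x = ⊤ := by
  rw [objective, hf, ← EReal.coe_toReal hgt hgb, EReal.top_add_coe, EReal.top_sub_coe]

/-- A Fréchet subgradient of `Φ` yields one of `(x, y) ↦ Φ x + c ‖x - y‖ ^ 2`. -/
theorem toLp_mem_frechetSubdiff {Φ : H → EReal} {c : ℝ} (hc : 0 ≤ c) {x y w : H}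
    (hw : w ∈ frechetSubdiff Φ x) :
    WithLp.toLp 2 (w + (2 * c) • (x - y), -((2 * c) • (x - y))) ∈
      frechetSubdiff (fun z : WithLp 2 (H × H) =>
        Φ z.fst + ((c * ‖z.fst - z.snd‖ ^ 2 : ℝ) : EReal)) (WithLp.toLp 2 (x, y)) := by
  obtain ⟨hb, ht, hw⟩ := hw
  simp only [frechetSubdiff, Set.mem_ofPred_eq, WithLp.toLp_fst, WithLp.toLp_snd]
  rw [← EReal.coe_toReal ht hb] at hw ⊢
  rw [← EReal.coe_add]
  refine ⟨EReal.coe_ne_bot _, EReal.coe_ne_top _, fun ε hε => ?_⟩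
  have hfst : Tendsto (fun z : WithLp 2 (H × H) => z.fst) (𝓝 (WithLp.toLp 2 (x, y))) (𝓝 x) :=
    (WithLp.continuous_fst 2 H H).tendsto (WithLp.toLp 2 (x, y))
  filter_upwards [hfst.eventually (hw ε hε)] with z hz
  have hnorm : ‖z.fst - x‖ ≤ ‖z - WithLp.toLp 2 (x, y)‖ := by
    have := WithLp.norm_fst_le (x := z - WithLp.toLp 2 (x, y))
    simpa using this
  have hinner : ⟪WithLp.toLp 2 (w + (2 * c) • (x - y), -((2 * c) • (x - y))),
      z - WithLp.toLp 2 (x, y)⟫ =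
      ⟪w, z.fst - x⟫ + 2 * c * ⟪x - y, (z.fst - z.snd) - (x - y)⟫ := by
    rw [WithLp.prod_inner_apply]
    simp only [WithLp.ofLp_fst, WithLp.ofLp_snd, WithLp.sub_fst, WithLp.sub_snd, WithLp.toLp_fst,
      WithLp.toLp_snd, inner_add_left, inner_neg_left, inner_smul_left, RCLike.conj_to_real]
    simp only [inner_sub_right]
    ring
  -- The quadratic term is convex because `c ≥ 0`, so its linearization is a global minorant and
  -- leaves no error for `ε` to absorb.
  have hsq : c * ‖x - y‖ ^ 2 + 2 * c * ⟪x - y, (z.fst - z.snd) - (x - y)⟫ ≤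
      c * ‖z.fst - z.snd‖ ^ 2 := by
    have h1 : z.fst - z.snd = (x - y) + ((z.fst - z.snd) - (x - y)) := by abel
    have h2 := norm_add_sq_real (x - y) ((z.fst - z.snd) - (x - y))
    rw [← h1] at h2
    rw [h2]
    have : 0 ≤ c * ‖(z.fst - z.snd) - (x - y)‖ ^ 2 := by positivity
    linarith
  rw [← EReal.coe_add] at hz ⊢
  rw [hinner]
  refine le_trans ?_ (add_le_add_left hz _)
  rw [← EReal.coe_add, EReal.coe_le_coe_iff]
  have := mul_le_mul_of_nonneg_left hnorm hε.le
  linarith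

variable [CompleteSpace H] [CompleteSpace K]

/-- The optimality condition for a proximal subgradient step. -/
theorem mem_frechetSubdiff_of_isMinOn {C : Set H} {f : H → EReal} {h : K → ℝ} {A : H →L[ℝ] K}
    {g : H → EReal} (hfb : ∀ x, f x ≠ ⊥) (hh : Differentiable ℝ h) (hgb : ∀ x, g x ≠ ⊥)
    (hgt : ∀ x ∈ C, g x ≠ ⊤) {x v q s : H} {τ : ℝ} (hx : x ∈ C) (hfx : f x ≠ ⊤)
    (hg : DifferentiableAt ℝ (fun y => (g y).toReal) x)
    (hmin : IsMinOn (fun y : H => f y + ((1 / (2 * τ) * ‖y - v + τ • q - τ • s‖ ^ 2 : ℝ) : EReal))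
      C x) :
    ContinuousLinearMap.adjoint A (gradient h (A x)) - gradient (fun y => (g y).toReal) x
      - (1 / τ) • (x - v + τ • q - τ • s) ∈
      frechetSubdiff (addIndicator C (objective f h A g)) x := by
  -- Minimality bounds `f` on `C` from below by a constant minus the proximal quadratic. Adding `h ∘
  -- A - g` gives a minorant of `F + ι_C`, differentiable at `x` and touching there.
  refine mem_frechetSubdiff_of_minorant (a := realObjective f h A g x)
    (ψ := fun y => h (A y) - (g y).toReal - 1 / (2 * τ) * ‖y - v + τ • q - τ • s‖ ^ 2)
    ?_ ?_ (Eventually.of_forall fun y => ?_)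
  · rw [addIndicator, if_pos hx, objective_eq_coe (hfb x) hfx (hgb x) (hgt x hx)]
  · rw [hasGradientAt_iff_hasFDerivAt]
    have h1 : HasFDerivAt (fun y => h (A y)) _ x :=
      (hh (A x)).hasGradientAt.hasFDerivAt.comp x A.hasFDerivAt
    have h2 := hg.hasGradientAt.hasFDerivAt
    have h3 : HasFDerivAt (fun y : H => y - v + τ • q - τ • s) (ContinuousLinearMap.id ℝ H) x :=
      (((hasFDerivAt_id x).sub_const v).add_const (τ • q)).sub_const (τ • s)
    have h4 := (h3.norm_sq).const_mul (1 / (2 * τ))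
    refine ((h1.sub h2).sub h4).congr_fderiv ?_
    ext k
    simp only [sub_apply, smul_apply, ContinuousLinearMap.comp_apply, ContinuousLinearMap.id_apply,
      InnerProductSpace.toDual_apply_apply, innerSL_apply_apply, inner_sub_left, inner_smul_left,
      ContinuousLinearMap.adjoint_inner_left, RCLike.conj_to_real, smul_eq_mul, nsmul_eq_mul,
      Nat.cast_ofNat]
    ring
  · by_cases hy : y ∈ C
    swap
    · rw [addIndicator, if_neg hy]; exact le_top
    rw [addIndicator, if_pos hy]
    by_cases hfy : f y = ⊤
    · rw [objective_eq_top hfy (hgb y) (hgt y hy)]; exact le_top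
    rw [objective_eq_coe (hfb y) hfy (hgb y) (hgt y hy), EReal.coe_le_coe_iff]
    have h1 := hmin hy
    simp only [Set.mem_ofPred_eq] at h1
    rw [← EReal.coe_toReal hfy (hfb y), ← EReal.coe_toReal hfx (hfb x), ← EReal.coe_add,
      ← EReal.coe_add, EReal.coe_le_coe_iff] at h1
    simp only [realObjective]
    linarith

/-- The decrease of the objective function in one proximal subgradient step. -/
theorem descent_of_step {h : K → ℝ} {A : H →L[ℝ] K} {ℓ : ℝ≥0} (hh : Differentiable ℝ h)
    (hl : LipschitzWith ℓ (gradient h)) {β δ lamBar muBar lam mu τ : ℝ}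
    (hlam : lam ∈ Set.Icc 0 lamBar) (hmu : mu ∈ Set.Icc 0 (muBar * τ)) (hτ : 0 < τ)
    (hτ' : β + 2 * δ + ℓ * ‖A‖ ^ 2 * (2 * lamBar + 1) + 2 * muBar ≤ 1 / τ)
    {x x' z s : H} {a b p q : ℝ}
    (hmin : b + 1 / (2 * τ) * ‖z - (x + mu • (x - x'))
        + τ • ContinuousLinearMap.adjoint A (gradient h (A (x + lam • (x - x')))) - τ • s‖ ^ 2 ≤
      a + 1 / (2 * τ) * ‖x - (x + mu • (x - x'))
        + τ • ContinuousLinearMap.adjoint A (gradient h (A (x + lam • (x - x')))) - τ • s‖ ^ 2)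
    (hg : p + ⟪s, z - x⟫ - β / 2 * ‖z - x‖ ^ 2 ≤ q) :
    b + h (A z) - q + (1 / 2 * (ℓ * ‖A‖ ^ 2 * lamBar + muBar) + δ) * ‖z - x‖ ^ 2 ≤
      a + h (A x) - p + 1 / 2 * (ℓ * ‖A‖ ^ 2 * lamBar + muBar) * ‖x - x'‖ ^ 2 := by
  set d := z - x with hd
  set w := x - x' with hw
  set r := gradient h (A (x + lam • w)) with hr
  set k : H := τ • ContinuousLinearMap.adjoint A r - τ • s - mu • w with hk
  have e1 : z - (x + mu • w) + τ • ContinuousLinearMap.adjoint A r - τ • s = d + k := by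
    rw [hk, hd]; abel
  have e2 : x - (x + mu • w) + τ • ContinuousLinearMap.adjoint A r - τ • s = k := by
    rw [hk]; abel
  rw [e1, e2, norm_add_sq_real] at hmin
  have e3 : ⟪d, k⟫ = τ * ⟪A d, r⟫ - τ * ⟪s, d⟫ - mu * ⟪d, w⟫ := by
    rw [hk, inner_sub_right, inner_sub_right, inner_smul_right, inner_smul_right, inner_smul_right,
      ContinuousLinearMap.adjoint_inner_right, real_inner_comm d s]
  have h1 : b + 1 / (2 * τ) * ‖d‖ ^ 2 + ⟪A d, r⟫ - ⟪s, d⟫ - mu / τ * ⟪d, w⟫ ≤ a := by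
    have e4 : 1 / (2 * τ) * (‖d‖ ^ 2 + 2 * ⟪d, k⟫ + ‖k‖ ^ 2) =
        1 / (2 * τ) * ‖d‖ ^ 2 + ⟪A d, r⟫ - ⟪s, d⟫ - mu / τ * ⟪d, w⟫ + 1 / (2 * τ) * ‖k‖ ^ 2 := by
      rw [e3]; field_simp; ring
    rw [e4] at hmin
    linarith
  have hcs : ⟪d, w⟫ ≤ (‖d‖ ^ 2 + ‖w‖ ^ 2) / 2 := by
    linarith [real_inner_le_norm d w, sq_nonneg (‖d‖ - ‖w‖)]
  have hmuτ0 : 0 ≤ mu / τ := div_nonneg hmu.1 hτ.le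
  have hmuτ : mu / τ ≤ muBar := by rw [div_le_iff₀ hτ]; exact hmu.2
  have h2 : mu / τ * ⟪d, w⟫ ≤ muBar * ((‖d‖ ^ 2 + ‖w‖ ^ 2) / 2) := by
    refine (mul_le_mul_of_nonneg_left hcs hmuτ0).trans ?_
    gcongr
  have h3 := le_add_of_lipschitzWith_gradient hh hl (A x) (A z)
  rw [← map_sub, ← hd] at h3
  have hA : ‖A d‖ ≤ ‖A‖ * ‖d‖ := A.le_opNorm d
  have h4 : (ℓ : ℝ) / 2 * ‖A d‖ ^ 2 ≤ ℓ / 2 * (‖A‖ * ‖d‖) ^ 2 := by gcongr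
  -- The price of evaluating `∇h` at the extrapolated point, split evenly between the new step `d`
  -- and the old step `w`.
  have h5 : ⟪gradient h (A x), A d⟫ - ⟪A d, r⟫ ≤
      ℓ * ‖A‖ ^ 2 * lamBar * ((‖d‖ ^ 2 + ‖w‖ ^ 2) / 2) := by
    rw [real_inner_comm, ← inner_sub_right]
    have h6 := real_inner_le_norm (A d) (gradient h (A x) - r)
    have h7 := hl.dist_le_mul (A x) (A (x + lam • w))
    rw [dist_eq_norm, dist_eq_norm, ← map_sub, sub_add_cancel_left, map_neg, norm_neg,
      map_smul, norm_smul, Real.norm_eq_abs, abs_of_nonneg hlam.1, ← hr] at h7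
    have h8 : lam * ‖A w‖ ≤ lamBar * (‖A‖ * ‖w‖) :=
      mul_le_mul hlam.2 (A.le_opNorm w) (norm_nonneg _) (hlam.1.trans hlam.2)
    have hlb : 0 ≤ lamBar := hlam.1.trans hlam.2
    calc ⟪A d, gradient h (A x) - r⟫ ≤ ‖A d‖ * ‖gradient h (A x) - r‖ := h6
      _ ≤ (‖A‖ * ‖d‖) * (ℓ * (lamBar * (‖A‖ * ‖w‖))) := by
          gcongr
          exact h7.trans (by gcongr)
      _ = ℓ * ‖A‖ ^ 2 * lamBar * (‖d‖ * ‖w‖) := by ring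
      _ ≤ _ := by
          gcongr
          linarith [sq_nonneg (‖d‖ - ‖w‖)]
  -- The step size bound enters here: the proximal term covers the errors in `‖d‖ ^ 2` from `g`, `h`
  -- and both extrapolations, and leaves the coefficient of the merit function plus `δ`.
  have h9 : (β + 2 * δ + ℓ * ‖A‖ ^ 2 * (2 * lamBar + 1) + 2 * muBar) / 2 * ‖d‖ ^ 2 ≤
      1 / (2 * τ) * ‖d‖ ^ 2 := by
    have : 1 / (2 * τ) = 1 / τ / 2 := by field_simp
    rw [this]
    gcongr
  linarith

end Objective

/-! ### Estimates along the sequence -/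

section Algorithm

variable {H K : Type*} [NormedAddCommGroup H] [InnerProductSpace ℝ H] [CompleteSpace H]
  [NormedAddCommGroup K] [InnerProductSpace ℝ K] [CompleteSpace K]

/-- The standing assumptions on the problem and on the sequence generated by the algorithm, with
`T` an upper bound for the inverse step sizes. -/
structure IsProxSetting (C : Set H) (f : H → EReal) (h : K → ℝ) (A : H →L[ℝ] K) (g : H → EReal)
    (ℓ ℓg : ℝ≥0) (β lamBar muBar δ T : ℝ) (O U : Set H) (x s : ℕ → H) (lam mu τ : ℕ → ℝ) :
    Prop where
  isClosed : IsClosed C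
  f_bot : ∀ x, f x ≠ ⊥
  f_lsc : LowerSemicontinuous f
  nonempty : (C ∩ dom f).Nonempty
  h_diff : Differentiable ℝ h
  h_lip : LipschitzWith ℓ (gradient h)
  beta_nonneg : 0 ≤ β
  isOpen : IsOpen O
  subset : C ⊆ O
  g_bot : ∀ x, g x ≠ ⊥
  g_top : ∀ x ∈ O, g x ≠ ⊤
  g_cont : ContinuousOn g O
  g_conv : ConvexOn ℝ O (fun x => (g x).toReal + β / 2 * ‖x‖ ^ 2)
  lamBar_nonneg : 0 ≤ lamBar
  muBar_nonneg : 0 ≤ muBar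
  delta_pos : 0 < δ
  sequence : IsAlgorithmSequence C f h A g β ℓ lamBar muBar δ x s lam mu τ
  bddBelow : ∃ m : ℝ, ∀ y ∈ C, (m : EReal) ≤ objective f h A g y
  level_bounded : Bornology.IsBounded
    {y | y ∈ C ∧ objective f h A g y ≤ objective f h A g (x 0)}
  isOpen_U : IsOpen U
  subset_U : C ∩ dom f ⊆ U
  g_diff : DifferentiableOn ℝ (fun y => (g y).toReal) U
  g_lip : LipschitzOnWith ℓg (gradient (fun y => (g y).toReal)) (C ∩ dom f)
  inv_le : ∀ n, 1 / τ n ≤ T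

namespace IsProxSetting

variable {C : Set H} {f : H → EReal} {h : K → ℝ} {A : H →L[ℝ] K} {g : H → EReal}
  {ℓ ℓg : ℝ≥0} {β lamBar muBar δ T : ℝ} {O U : Set H} {x s : ℕ → H} {lam mu τ : ℕ → ℝ}

theorem mem (hS : IsProxSetting C f h A g ℓ ℓg β lamBar muBar δ T O U x s lam mu τ) (n : ℕ) :
    x n ∈ C := by
  cases n with
  | zero => exact hS.sequence.start_mem
  | succ n => exact hS.sequence.step_mem n

theorem g_ne_top (hS : IsProxSetting C f h A g ℓ ℓg β lamBar muBar δ T O U x s lam mu τ) {y : H}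
    (hy : y ∈ C) : g y ≠ ⊤ := hS.g_top y (hS.subset hy)

theorem tau_pos (hS : IsProxSetting C f h A g ℓ ℓg β lamBar muBar δ T O U x s lam mu τ) (n : ℕ) :
    0 < τ n := (hS.sequence.tau_mem n).1

theorem f_succ_ne_top (hS : IsProxSetting C f h A g ℓ ℓg β lamBar muBar δ T O U x s lam mu τ)
    (n : ℕ) : f (x (n + 1)) ≠ ⊤ := by
  obtain ⟨y, hy, hfy⟩ := hS.nonempty
  intro htop
  have h1 := hS.sequence.step_min n hy
  simp only [Set.mem_ofPred_eq] at h1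
  rw [htop, EReal.top_add_coe, top_le_iff, ← EReal.coe_toReal (ne_of_lt hfy) (hS.f_bot y),
    ← EReal.coe_add] at h1
  exact EReal.coe_ne_top _ h1

theorem step_le (hS : IsProxSetting C f h A g ℓ ℓg β lamBar muBar δ T O U x s lam mu τ) (n : ℕ)
    {y : H} (hy : y ∈ C) (hfy : f y ≠ ⊤) :
    (f (x (n + 1))).toReal + 1 / (2 * τ n) * ‖x (n + 1) - (x n + mu n • (x n - x (n - 1)))
        + τ n • ContinuousLinearMap.adjoint A (gradient h (A (x n + lam n • (x n - x (n - 1)))))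
        - τ n • s n‖ ^ 2 ≤
      (f y).toReal + 1 / (2 * τ n) * ‖y - (x n + mu n • (x n - x (n - 1)))
        + τ n • ContinuousLinearMap.adjoint A (gradient h (A (x n + lam n • (x n - x (n - 1)))))
        - τ n • s n‖ ^ 2 := by
  have h1 := hS.sequence.step_min n hy
  simp only [Set.mem_ofPred_eq] at h1
  rwa [← EReal.coe_toReal hfy (hS.f_bot y),
    ← EReal.coe_toReal (hS.f_succ_ne_top n) (hS.f_bot _), ← EReal.coe_add, ← EReal.coe_add,
    EReal.coe_le_coe_iff] at h1

theorem differentiableAt (hS : IsProxSetting C f h A g ℓ ℓg β lamBar muBar δ T O U x s lam mu τ)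
    {y : H} (hy : y ∈ C) (hfy : f y ≠ ⊤) : DifferentiableAt ℝ (fun y => (g y).toReal) y :=
  hS.g_diff.differentiableAt (hS.isOpen_U.mem_nhds (hS.subset_U ⟨hy, lt_top_iff_ne_top.2 hfy⟩))

theorem subgrad_eq (hS : IsProxSetting C f h A g ℓ ℓg β lamBar muBar δ T O U x s lam mu τ)
    {n : ℕ} (hn : f (x n) ≠ ⊤) : s n = gradient (fun y => (g y).toReal) (x n) :=
  weaklyConvex_limitingSubdiff_eq_gradient hS.beta_nonneg hS.isOpen hS.g_bot hS.g_top hS.g_conv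
    (hS.subset (hS.mem n)) (hS.differentiableAt (hS.mem n) hn) (hS.sequence.subgrad_mem n)

theorem objective_eq (hS : IsProxSetting C f h A g ℓ ℓg β lamBar muBar δ T O U x s lam mu τ)
    {y : H} (hy : y ∈ C) (hfy : f y ≠ ⊤) :
    objective f h A g y = (realObjective f h A g y : ℝ) :=
  objective_eq_coe (hS.f_bot y) hfy (hS.g_bot y) (hS.g_ne_top hy)

theorem descent (hS : IsProxSetting C f h A g ℓ ℓg β lamBar muBar δ T O U x s lam mu τ)
    {n : ℕ} (hn : f (x n) ≠ ⊤) :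
    realObjective f h A g (x (n + 1)) +
        (1 / 2 * (ℓ * ‖A‖ ^ 2 * lamBar + muBar) + δ) * ‖x (n + 1) - x n‖ ^ 2 ≤
      realObjective f h A g (x n) +
        1 / 2 * (ℓ * ‖A‖ ^ 2 * lamBar + muBar) * ‖x n - x (n - 1)‖ ^ 2 := by
  have hden : 0 < β + 2 * δ + ℓ * ‖A‖ ^ 2 * (2 * lamBar + 1) + 2 * muBar := by
    have := hS.beta_nonneg; have := hS.delta_pos; have := hS.lamBar_nonneg
    have := hS.muBar_nonneg
    positivity
  refine descent_of_step hS.h_diff hS.h_lip (hS.sequence.lam_mem n) (hS.sequence.mu_mem n)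
    (hS.tau_pos n) ?_ (hS.step_le n (hS.mem n) hn)
    (weaklyConvex_le_of_limitingSubdiff hS.beta_nonneg hS.isOpen hS.g_bot hS.g_top hS.g_conv
      (hS.subset (hS.mem n)) (hS.sequence.subgrad_mem n) (hS.subset (hS.mem (n + 1))))
  rw [le_div_comm₀ hden (hS.tau_pos n)]
  exact (hS.sequence.tau_mem n).2

theorem coeff_nonneg (hS : IsProxSetting C f h A g ℓ ℓg β lamBar muBar δ T O U x s lam mu τ) :
    0 ≤ 1 / 2 * (ℓ * ‖A‖ ^ 2 * lamBar + muBar) := by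
  have := hS.lamBar_nonneg
  have := hS.muBar_nonneg
  positivity

theorem exists_norm_le (hS : IsProxSetting C f h A g ℓ ℓg β lamBar muBar δ T O U x s lam mu τ) :
    ∃ R : ℝ, 0 ≤ R ∧ ∀ n, ‖x n‖ ≤ R := by
  obtain ⟨R, hR⟩ := hS.level_bounded.exists_norm_le
  refine ⟨max R 0, le_max_right _ _, fun n => le_max_of_le_left (hR _ ⟨hS.mem n, ?_⟩)⟩
  -- If `f (x 0) = ⊤`, the level set is all of `C`. Otherwise the merit values decrease from `F (x
  -- 0)`, the initial step being zero because `0 - 1 = 0`.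
  by_cases h0 : f (x 0) = ⊤
  · rw [objective_eq_top h0 (hS.g_bot _) (hS.g_ne_top (hS.mem 0))]
    exact le_top
  have hfin : ∀ n, f (x n) ≠ ⊤ := fun n => by
    cases n with
    | zero => exact h0
    | succ n => exact hS.f_succ_ne_top n
  rw [hS.objective_eq (hS.mem n) (hfin n), hS.objective_eq (hS.mem 0) h0, EReal.coe_le_coe_iff]
  have hc := hS.coeff_nonneg
  set c := 1 / 2 * (ℓ * ‖A‖ ^ 2 * lamBar + muBar) with hcdef
  have key : ∀ n, realObjective f h A g (x n) + c * ‖x n - x (n - 1)‖ ^ 2 ≤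
      realObjective f h A g (x 0) := by
    intro n
    induction n with
    | zero => simp
    | succ n ih =>
      have h1 := hS.descent (hfin n)
      rw [← hcdef] at h1
      have h2 : 0 ≤ δ * ‖x (n + 1) - x n‖ ^ 2 := by have := hS.delta_pos; positivity
      rw [Nat.add_sub_cancel]
      linarith
  have : 0 ≤ c * ‖x n - x (n - 1)‖ ^ 2 := by positivity
  linarith [key n]

/-- The objective function has small subgradients along the sequence. -/
theorem exists_subgradient_bound
    (hS : IsProxSetting C f h A g ℓ ℓg β lamBar muBar δ T O U x s lam mu τ) :
    ∃ M > 0, ∀ n, ∃ w ∈ frechetSubdiff (addIndicator C (objective f h A g)) (x (n + 2)),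
      ‖w‖ ≤ M * (‖x (n + 2) - x (n + 1)‖ + ‖x (n + 1) - x n‖) := by
  have hlb := hS.lamBar_nonneg
  have hmb := hS.muBar_nonneg
  have hT : 0 ≤ T := (one_div_pos.2 (hS.tau_pos 0)).le.trans (hS.inv_le 0)
  refine ⟨ℓ * ‖A‖ ^ 2 * (1 + lamBar) + ℓg + T + muBar + 1, by positivity, fun n => ?_⟩
  refine ⟨_, mem_frechetSubdiff_of_isMinOn hS.f_bot hS.h_diff hS.g_bot (fun y => hS.g_ne_top)
    (hS.mem (n + 2)) (hS.f_succ_ne_top (n + 1))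
    (hS.differentiableAt (hS.mem (n + 2)) (hS.f_succ_ne_top (n + 1)))
    (hS.sequence.step_min (n + 1)), ?_⟩
  -- `s (n + 1)` is a gradient because `f (x (n + 1))` is finite. At `x 0` this may fail, so the
  -- bound begins with `x 2`.
  have hs := hS.subgrad_eq (hS.f_succ_ne_top n)
  have hτ := hS.tau_pos (n + 1)
  have hlam := hS.sequence.lam_mem (n + 1)
  have hmu := hS.sequence.mu_mem (n + 1)
  rw [Nat.add_sub_cancel, hs]
  set d := x (n + 2) - x (n + 1) with hd
  set w := x (n + 1) - x n with hw
  set G' := gradient (fun y => (g y).toReal) with hG'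
  set u := x (n + 1) + lam (n + 1) • w with hu
  have e : ContinuousLinearMap.adjoint A (gradient h (A (x (n + 2)))) - G' (x (n + 2)) -
      (1 / τ (n + 1)) • (x (n + 2) - (x (n + 1) + mu (n + 1) • w) +
        τ (n + 1) • ContinuousLinearMap.adjoint A (gradient h (A u)) -
        τ (n + 1) • G' (x (n + 1))) =
      ContinuousLinearMap.adjoint A (gradient h (A (x (n + 2))) - gradient h (A u)) -
      (G' (x (n + 2)) - G' (x (n + 1))) - (1 / τ (n + 1)) • d
      + (mu (n + 1) / τ (n + 1)) • w := by
    have h1 : (1 / τ (n + 1)) * τ (n + 1) = 1 := by field_simp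
    rw [hd, map_sub, smul_sub, smul_add, smul_smul, smul_smul, h1, one_smul, one_smul,
      ← sub_sub, smul_sub _ _ (mu (n + 1) • w), smul_smul, one_div_mul_eq_div]
    abel
  rw [e]
  have n1 : ‖ContinuousLinearMap.adjoint A (gradient h (A (x (n + 2))) - gradient h (A u))‖ ≤
      ℓ * ‖A‖ ^ 2 * (‖d‖ + lamBar * ‖w‖) := by
    have h1 := hS.h_lip.dist_le_mul (A (x (n + 2))) (A u)
    rw [dist_eq_norm, dist_eq_norm, ← map_sub] at h1
    have h2 : ‖x (n + 2) - u‖ ≤ ‖d‖ + lamBar * ‖w‖ := by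
      have : x (n + 2) - u = d - lam (n + 1) • w := by rw [hu, hd]; abel
      rw [this]
      refine (norm_sub_le _ _).trans ?_
      rw [norm_smul, Real.norm_eq_abs, abs_of_nonneg hlam.1]
      have := hlam.2
      gcongr
    calc _ ≤ ‖A‖ * ‖gradient h (A (x (n + 2))) - gradient h (A u)‖ := by
          refine (ContinuousLinearMap.le_opNorm _ _).trans (le_of_eq ?_)
          rw [LinearIsometryEquiv.norm_map]
      _ ≤ ‖A‖ * (ℓ * (‖A‖ * (‖d‖ + lamBar * ‖w‖))) := by
          gcongr
          refine h1.trans ?_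
          gcongr
          exact (A.le_opNorm _).trans (by gcongr)
      _ = _ := by ring
  have n2 : ‖G' (x (n + 2)) - G' (x (n + 1))‖ ≤ ℓg * ‖d‖ := by
    have := hS.g_lip.dist_le_mul (x (n + 2))
      ⟨hS.mem _, lt_top_iff_ne_top.2 (hS.f_succ_ne_top (n + 1))⟩ (x (n + 1))
      ⟨hS.mem _, lt_top_iff_ne_top.2 (hS.f_succ_ne_top n)⟩
    rwa [dist_eq_norm, dist_eq_norm] at this
  have n3 : ‖(1 / τ (n + 1)) • d‖ ≤ T * ‖d‖ := by
    rw [norm_smul, Real.norm_eq_abs, abs_of_pos (one_div_pos.2 hτ)]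
    exact mul_le_mul_of_nonneg_right (hS.inv_le _) (norm_nonneg _)
  have n4 : ‖(mu (n + 1) / τ (n + 1)) • w‖ ≤ muBar * ‖w‖ := by
    rw [norm_smul, Real.norm_eq_abs, abs_of_nonneg (div_nonneg hmu.1 hτ.le)]
    refine mul_le_mul_of_nonneg_right ?_ (norm_nonneg _)
    rw [div_le_iff₀ hτ]
    exact hmu.2
  have n5 := norm_add_le (ContinuousLinearMap.adjoint A
    (gradient h (A (x (n + 2))) - gradient h (A u)) - (G' (x (n + 2)) - G' (x (n + 1)))
      - (1 / τ (n + 1)) • d) ((mu (n + 1) / τ (n + 1)) • w)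
  have n6 := norm_sub_le (ContinuousLinearMap.adjoint A
    (gradient h (A (x (n + 2))) - gradient h (A u)) - (G' (x (n + 2)) - G' (x (n + 1))))
      ((1 / τ (n + 1)) • d)
  have n7 := norm_sub_le (ContinuousLinearMap.adjoint A
    (gradient h (A (x (n + 2))) - gradient h (A u))) (G' (x (n + 2)) - G' (x (n + 1)))
  have hd0 := norm_nonneg d
  have hw0 := norm_nonneg w
  have p1 : 0 ≤ (ℓ : ℝ) * ‖A‖ ^ 2 * ‖w‖ := by positivity
  have p2 : 0 ≤ (ℓ : ℝ) * ‖A‖ ^ 2 * lamBar * ‖d‖ := by positivity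
  have p3 : 0 ≤ (ℓg : ℝ) * ‖w‖ := by positivity
  have p4 : 0 ≤ T * ‖w‖ := by positivity
  have p5 : 0 ≤ muBar * ‖d‖ := by positivity
  linarith

/-- The values of `f` along the sequence are controlled by its value at any point of the
feasible set. -/
theorem exists_f_le (hS : IsProxSetting C f h A g ℓ ℓg β lamBar muBar δ T O U x s lam mu τ)
    {a : H} (ha : a ∈ C) (hfa : f a ≠ ⊤) :
    ∃ B : ℝ, ∀ n, (f (x (n + 2))).toReal ≤ (f a).toReal + B * ‖a - x (n + 2)‖ := by
  obtain ⟨R, hR0, hR⟩ := hS.exists_norm_le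
  have hlb := hS.lamBar_nonneg
  have hmb := hS.muBar_nonneg
  have hT : 0 ≤ T := (one_div_pos.2 (hS.tau_pos 0)).le.trans (hS.inv_le 0)
  set G' := gradient (fun y => (g y).toReal) with hG'
  refine ⟨T * (‖a‖ + R) + muBar * (2 * R) + ‖A‖ * (‖gradient h 0‖ +
    ℓ * (‖A‖ * (R + lamBar * (2 * R)))) + (‖G' (x 1)‖ + ℓg * (2 * R)), fun n => ?_⟩
  have hle := hS.step_le (n + 1) ha hfa
  have hs := hS.subgrad_eq (hS.f_succ_ne_top n)
  have hτ := hS.tau_pos (n + 1)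
  have hlam := hS.sequence.lam_mem (n + 1)
  have hmu := hS.sequence.mu_mem (n + 1)
  rw [Nat.add_sub_cancel, hs] at hle
  have hdiff : ∀ i j, ‖x i - x j‖ ≤ 2 * R := fun i j => by
    linarith [norm_sub_le (x i) (x j), hR i, hR j]
  set w := x (n + 1) - x n with hw
  set u := x (n + 1) + lam (n + 1) • w with hu
  set q := ContinuousLinearMap.adjoint A (gradient h (A u)) with hq
  set k := a - (x (n + 1) + mu (n + 1) • w) + τ (n + 1) • q - τ (n + 1) • G' (x (n + 1)) with hk
  have e1 : x (n + 1 + 1) - (x (n + 1) + mu (n + 1) • w) + τ (n + 1) • q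
      - τ (n + 1) • G' (x (n + 1)) = k - (a - x (n + 2)) := by rw [hk]; abel
  rw [e1, norm_sub_sq_real] at hle
  -- Subtracting the two proximal quadratics leaves an inner product with `k / τ`. Its norm is
  -- bounded uniformly in `n`, since the iterates are bounded, the gradients Lipschitz and the
  -- inverse step sizes at most `T`.
  have hkb : 1 / τ (n + 1) * ‖k‖ ≤ T * (‖a‖ + R) + muBar * (2 * R) + ‖A‖ * (‖gradient h 0‖ +
      ℓ * (‖A‖ * (R + lamBar * (2 * R)))) + (‖G' (x 1)‖ + ℓg * (2 * R)) := by
    have e2 : (1 / τ (n + 1)) • k = (1 / τ (n + 1)) • (a - x (n + 1))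
        - (mu (n + 1) / τ (n + 1)) • w + q - G' (x (n + 1)) := by
      have h1 : (1 / τ (n + 1)) * τ (n + 1) = 1 := by field_simp
      rw [hk, smul_sub, smul_add, smul_smul, smul_smul, h1, one_smul, one_smul, ← sub_sub,
        smul_sub _ _ (mu (n + 1) • w), smul_smul, one_div_mul_eq_div]
    have e3 : 1 / τ (n + 1) * ‖k‖ = ‖(1 / τ (n + 1)) • k‖ := by
      rw [norm_smul, Real.norm_eq_abs, abs_of_pos (one_div_pos.2 hτ)]
    rw [e3, e2]
    have n1 : ‖(1 / τ (n + 1)) • (a - x (n + 1))‖ ≤ T * (‖a‖ + R) := by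
      rw [norm_smul, Real.norm_eq_abs, abs_of_pos (one_div_pos.2 hτ)]
      refine mul_le_mul (hS.inv_le _) ?_ (norm_nonneg _) hT
      linarith [norm_sub_le a (x (n + 1)), hR (n + 1)]
    have n2 : ‖(mu (n + 1) / τ (n + 1)) • w‖ ≤ muBar * (2 * R) := by
      rw [norm_smul, Real.norm_eq_abs, abs_of_nonneg (div_nonneg hmu.1 hτ.le)]
      refine mul_le_mul ?_ (hdiff _ _) (norm_nonneg _) hmb
      rw [div_le_iff₀ hτ]
      exact hmu.2
    have n3 : ‖q‖ ≤ ‖A‖ * (‖gradient h 0‖ + ℓ * (‖A‖ * (R + lamBar * (2 * R)))) := by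
      have h1 := hS.h_lip.dist_le_mul (A u) 0
      rw [dist_eq_norm, dist_zero_right] at h1
      have h2 : ‖u‖ ≤ R + lamBar * (2 * R) := by
        refine (norm_add_le _ _).trans (add_le_add (hR _) ?_)
        rw [norm_smul, Real.norm_eq_abs, abs_of_nonneg hlam.1]
        exact mul_le_mul hlam.2 (hdiff _ _) (norm_nonneg _) hlb
      have h3 : ‖gradient h (A u)‖ ≤ ‖gradient h 0‖ + ℓ * ‖A u‖ := by
        linarith [norm_sub_norm_le (gradient h (A u)) (gradient h 0)]
      calc ‖q‖ ≤ ‖A‖ * ‖gradient h (A u)‖ := by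
            refine (ContinuousLinearMap.le_opNorm _ _).trans (le_of_eq ?_)
            rw [LinearIsometryEquiv.norm_map]
        _ ≤ _ := by
            gcongr
            refine h3.trans ?_
            gcongr
            exact (A.le_opNorm _).trans (by gcongr)
    have n4 : ‖G' (x (n + 1))‖ ≤ ‖G' (x 1)‖ + ℓg * (2 * R) := by
      have h1 := hS.g_lip.dist_le_mul (x (n + 1))
        ⟨hS.mem _, lt_top_iff_ne_top.2 (hS.f_succ_ne_top n)⟩ (x 1)
        ⟨hS.mem _, lt_top_iff_ne_top.2 (hS.f_succ_ne_top 0)⟩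
      rw [dist_eq_norm, dist_eq_norm] at h1
      have h2 : (ℓg : ℝ) * ‖x (n + 1) - x 1‖ ≤ ℓg * (2 * R) := by gcongr; exact hdiff _ _
      linarith [norm_sub_norm_le (G' (x (n + 1))) (G' (x 1))]
    have n5 := norm_sub_le ((1 / τ (n + 1)) • (a - x (n + 1))
        - (mu (n + 1) / τ (n + 1)) • w + q) (G' (x (n + 1)))
    have n6 := norm_add_le ((1 / τ (n + 1)) • (a - x (n + 1))
        - (mu (n + 1) / τ (n + 1)) • w) q
    have n7 := norm_sub_le ((1 / τ (n + 1)) • (a - x (n + 1))) ((mu (n + 1) / τ (n + 1)) • w)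
    linarith
  have h1 := real_inner_le_norm k (a - x (n + 2))
  have h2 : 1 / (2 * τ (n + 1)) * (2 * ⟪k, a - x (n + 2)⟫) ≤
      (T * (‖a‖ + R) + muBar * (2 * R) + ‖A‖ * (‖gradient h 0‖ +
      ℓ * (‖A‖ * (R + lamBar * (2 * R)))) + (‖G' (x 1)‖ + ℓg * (2 * R))) * ‖a - x (n + 2)‖ := by
    calc 1 / (2 * τ (n + 1)) * (2 * ⟪k, a - x (n + 2)⟫)
        = 1 / τ (n + 1) * ⟪k, a - x (n + 2)⟫ := by field_simp
      _ ≤ 1 / τ (n + 1) * (‖k‖ * ‖a - x (n + 2)‖) := by gcongr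
      _ = (1 / τ (n + 1) * ‖k‖) * ‖a - x (n + 2)‖ := by ring
      _ ≤ _ := by gcongr
  have h3 : 0 ≤ 1 / (2 * τ (n + 1)) * ‖a - x (n + 2)‖ ^ 2 := by positivity
  simp only [add_assoc, Nat.reduceAdd] at hle h2 ⊢
  linarith

end IsProxSetting

end Algorithm

/-! ### Stationary cluster points and the merit function -/

section Convergence

variable {H K : Type*} [NormedAddCommGroup H] [InnerProductSpace ℝ H] [CompleteSpace H]
  [NormedAddCommGroup K] [InnerProductSpace ℝ K] [CompleteSpace K]

namespace IsProxSetting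

variable {C : Set H} {f : H → EReal} {h : K → ℝ} {A : H →L[ℝ] K} {g : H → EReal}
  {ℓ ℓg : ℝ≥0} {β lamBar muBar δ T : ℝ} {O U : Set H} {x s : ℕ → H} {lam mu τ : ℕ → ℝ}

/-- The values of the merit function along the sequence converge. -/
theorem exists_tendsto_merit
    (hS : IsProxSetting C f h A g ℓ ℓg β lamBar muBar δ T O U x s lam mu τ)
    {c : ℝ} (hc : c = 1 / 2 * (ℓ * ‖A‖ ^ 2 * lamBar + muBar)) :
    ∃ v : ℝ, Tendsto (fun n => realObjective f h A g (x (n + 2)) +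
      c * ‖x (n + 2) - x (n + 1)‖ ^ 2) atTop (𝓝 v) ∧
      Tendsto (fun n => ‖x (n + 1) - x n‖) atTop (𝓝 0) := by
  have hδ := hS.delta_pos
  have hc0 : 0 ≤ c := hc ▸ hS.coeff_nonneg
  have hdesc : ∀ n, realObjective f h A g (x (n + 3)) + c * ‖x (n + 3) - x (n + 2)‖ ^ 2 +
      δ * ‖x (n + 3) - x (n + 2)‖ ^ 2 ≤
      realObjective f h A g (x (n + 2)) + c * ‖x (n + 2) - x (n + 1)‖ ^ 2 := fun n => by
    have h1 := hS.descent (hS.f_succ_ne_top (n + 1))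
    rw [← hc] at h1
    simp only [add_assoc, Nat.reduceAdd, Nat.add_one_sub_one] at h1 ⊢
    linarith
  have hanti : Antitone fun n => realObjective f h A g (x (n + 2)) +
      c * ‖x (n + 2) - x (n + 1)‖ ^ 2 := antitone_nat_of_succ_le fun n => by
    have : 0 ≤ δ * ‖x (n + 3) - x (n + 2)‖ ^ 2 := by positivity
    have := hdesc n
    simp only [add_assoc, Nat.reduceAdd] at this ⊢
    linarith
  obtain ⟨m, hm⟩ := hS.bddBelow
  have hbdd : BddBelow (Set.range fun n => realObjective f h A g (x (n + 2)) +
      c * ‖x (n + 2) - x (n + 1)‖ ^ 2) := by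
    refine ⟨m, ?_⟩
    rintro _ ⟨n, rfl⟩
    have h1 := hm _ (hS.mem (n + 2))
    rw [hS.objective_eq (hS.mem _) (hS.f_succ_ne_top (n + 1)), EReal.coe_le_coe_iff] at h1
    have : 0 ≤ c * ‖x (n + 2) - x (n + 1)‖ ^ 2 := by positivity
    simp only
    linarith
  have hlim := tendsto_atTop_ciInf hanti hbdd
  refine ⟨_, hlim, ?_⟩
  rw [← tendsto_add_atTop_iff_nat 2]
  have h1 := ((hlim.sub (hlim.comp (tendsto_add_atTop_nat 1))).div_const δ)
  rw [sub_self, zero_div] at h1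
  have h2 : Tendsto (fun n => ‖x (n + 2 + 1) - x (n + 2)‖ ^ 2) atTop (𝓝 0) := by
    refine squeeze_zero (fun _ => by positivity) (fun n => ?_) h1
    rw [le_div_iff₀ hδ]
    have := hdesc n
    simp only [Function.comp, add_assoc, Nat.reduceAdd] at this ⊢
    linarith
  have h3 := (Real.continuous_sqrt.tendsto 0).comp h2
  simpa [Function.comp_def, Real.sqrt_sq] using h3

/-- The sequence has a cluster point at which the merit function is continuous along the
sequence, and which is stationary both for the problem and for the merit function. -/
theorem exists_mapClusterPt [FiniteDimensional ℝ H]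
    (hS : IsProxSetting C f h A g ℓ ℓg β lamBar muBar δ T O U x s lam mu τ)
    {c : ℝ} (hc : c = 1 / 2 * (ℓ * ‖A‖ ^ 2 * lamBar + muBar)) :
    ∃ a ∈ C, f a ≠ ⊤ ∧ MapClusterPt a atTop (fun n => x (n + 1)) ∧
      Tendsto (fun n => realObjective f h A g (x (n + 2)) +
        c * ‖x (n + 2) - x (n + 1)‖ ^ 2) atTop (𝓝 (realObjective f h A g a)) ∧
      (0 : H) ∈ limitingSubdiff (addIndicator C (objective f h A g)) a ∧
      (0 : WithLp 2 (H × H)) ∈ limitingSubdiff (merit C f h A g c) (WithLp.toLp 2 (a, a)) := by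
  obtain ⟨v, hv, hstep⟩ := hS.exists_tendsto_merit hc
  have hc0 : 0 ≤ c := hc ▸ hS.coeff_nonneg
  obtain ⟨R, -, hR⟩ := hS.exists_norm_le
  obtain ⟨a, -, k, hk, hka⟩ := tendsto_subseq_of_bounded (s := Metric.closedBall (0 : H) R)
    Metric.isBounded_closedBall (x := x) fun n => by simpa using hR n
  have hka0 : Tendsto (fun j => x (k j)) atTop (𝓝 a) := hka
  have hkt := hk.tendsto_atTop
  have hd0 := hstep.comp hkt
  have hd1 := (hstep.comp (tendsto_add_atTop_nat 1)).comp hkt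
  have hka1 : Tendsto (fun j => x (k j + 1)) atTop (𝓝 a) := by
    have := (tendsto_zero_iff_norm_tendsto_zero.2 hd0).add hka0
    simpa using this
  have hka2 : Tendsto (fun j => x (k j + 2)) atTop (𝓝 a) := by
    have := (tendsto_zero_iff_norm_tendsto_zero.2 hd1).add hka1
    simpa using this
  have haC : a ∈ C := hS.isClosed.mem_of_tendsto hka (Eventually.of_forall fun j => hS.mem _)
  have hobj : Tendsto (fun j => realObjective f h A g (x (k j + 2))) atTop (𝓝 v) := by
    have h1 := (hv.comp hkt).sub ((hd1.pow 2).const_mul c)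
    simpa [Function.comp_def] using h1
  have hgc : Tendsto (fun j => (g (x (k j + 2))).toReal) atTop (𝓝 (g a).toReal) :=
    (EReal.tendsto_toReal (hS.g_ne_top haC) (hS.g_bot a)).comp
      ((hS.g_cont.continuousAt (hS.isOpen.mem_nhds (hS.subset haC))).tendsto.comp hka2)
  have hhc : Tendsto (fun j => h (A (x (k j + 2)))) atTop (𝓝 (h (A a))) :=
    ((hS.h_diff.continuous.comp A.continuous).tendsto a).comp hka2
  have hfc : Tendsto (fun j => (f (x (k j + 2))).toReal) atTop
      (𝓝 (v - h (A a) + (g a).toReal)) := by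
    refine ((hobj.sub hhc).add hgc).congr fun j => ?_
    simp only [realObjective]
    ring
  -- Lower semicontinuity gives this half, and with it the finiteness of `f a`; the reverse half
  -- rests on `exists_f_le`, which needs that finiteness.
  have hfle : f a ≤ ((v - h (A a) + (g a).toReal : ℝ) : EReal) := by
    by_contra! hlt
    obtain ⟨t, ht1, ht2⟩ := EReal.lt_iff_exists_real_btwn.1 hlt
    rw [EReal.coe_lt_coe_iff] at ht1
    have h1 := hka2.eventually (hS.f_lsc a _ ht2)
    refine absurd (ge_of_tendsto hfc (h1.mono fun j hj => ?_)) (not_le.2 ht1)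
    have hj' : (t : EReal) < f (x (k j + 1 + 1)) := hj
    rw [← EReal.coe_toReal (hS.f_succ_ne_top (k j + 1)) (hS.f_bot _), EReal.coe_lt_coe_iff] at hj'
    exact hj'.le
  have hfa : f a ≠ ⊤ := ne_top_of_le_ne_top (EReal.coe_ne_top _) hfle
  obtain ⟨B, hB⟩ := hS.exists_f_le haC hfa
  have hfge : v - h (A a) + (g a).toReal ≤ (f a).toReal := by
    have h1 : Tendsto (fun j => (f a).toReal + B * ‖a - x (k j + 2)‖) atTop
        (𝓝 ((f a).toReal + B * ‖a - a‖)) :=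
      ((tendsto_const_nhds.sub hka2).norm.const_mul B).const_add _
    rw [sub_self, norm_zero, mul_zero, add_zero] at h1
    exact le_of_tendsto_of_tendsto' hfc h1 fun j => hB (k j)
  rw [← EReal.coe_toReal hfa (hS.f_bot a), EReal.coe_le_coe_iff] at hfle
  obtain rfl : v = realObjective f h A g a := by
    simp only [realObjective]
    linarith
  obtain ⟨M, hM, hsub⟩ := hS.exists_subgradient_bound
  choose w hw hwM using hsub
  -- With convergence of the values, these vanishing subgradients put `0` in both limiting
  -- subdifferentials at the limit.
  have hw0 : Tendsto (fun j => w (k j)) atTop (𝓝 0) := by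
    refine squeeze_zero_norm (fun j => hwM (k j)) ?_
    simpa using (hd1.add hd0).const_mul M
  have hΦ : ∀ y ∈ C, f y ≠ ⊤ → addIndicator C (objective f h A g) y =
      (realObjective f h A g y : ℝ) := fun y hy hfy => by
    rw [addIndicator, if_pos hy, hS.objective_eq hy hfy]
  have hm : ∀ y ∈ C, f y ≠ ⊤ → ∀ z, merit C f h A g c (WithLp.toLp 2 (y, z)) =
      ((realObjective f h A g y + c * ‖y - z‖ ^ 2 : ℝ) : EReal) := fun y hy hfy z => by
    rw [merit, WithLp.toLp_fst, WithLp.toLp_snd, hΦ y hy hfy, ← EReal.coe_add]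
  refine ⟨a, haC, hfa, ?_, hv, ?_, ?_⟩
  · exact MapClusterPt.of_comp (φ := k) hkt hka1.mapClusterPt
  · rw [limitingSubdiff, Set.mem_ofPred_eq, hΦ a haC hfa]
    refine ⟨EReal.coe_ne_bot _, EReal.coe_ne_top _, fun j => x (k j + 2), fun j => w (k j), hka2,
      ?_, hw0, fun j => hw (k j)⟩
    simp_rw [hΦ _ (hS.mem _) (hS.f_succ_ne_top _)]
    exact EReal.tendsto_coe.2 hobj
  · rw [limitingSubdiff, Set.mem_ofPred_eq, hm a haC hfa]
    refine ⟨EReal.coe_ne_bot _, EReal.coe_ne_top _,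
      fun j => WithLp.toLp 2 (x (k j + 2), x (k j + 1)),
      fun j => WithLp.toLp 2 (w (k j) + (2 * c) • (x (k j + 2) - x (k j + 1)),
        -((2 * c) • (x (k j + 2) - x (k j + 1)))), ?_, ?_, ?_,
      fun j => toLp_mem_frechetSubdiff hc0 (hw (k j))⟩
    · exact ((WithLp.prod_continuous_toLp 2 H H).tendsto (a, a)).comp (hka2.prodMk_nhds hka1)
    · simp_rw [hm _ (hS.mem _) (hS.f_succ_ne_top _)]
      simp only [sub_self, norm_zero, ne_eq, OfNat.ofNat_ne_zero, not_false_eq_true, zero_pow,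
        mul_zero, add_zero]
      exact EReal.tendsto_coe.2 (hv.comp hkt)
    · have h1 : Tendsto (fun j => (2 * c) • (x (k j + 2) - x (k j + 1))) atTop (𝓝 0) := by
        simpa using (hka2.sub hka1).const_smul (2 * c)
      have h2 := (hw0.add h1).prodMk_nhds h1.neg
      have h3 := ((WithLp.prod_continuous_toLp 2 H H).tendsto _).comp h2
      rw [add_zero, neg_zero, show ((0 : H), (0 : H)) = 0 from rfl, WithLp.toLp_zero] at h3
      exact h3

/-- Links the algorithm to the abstract theory. The sequence is read from `x 1` on, where `f` is
finite. -/
theorem exists_isDescentSequence [FiniteDimensional ℝ H]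
    (hS : IsProxSetting C f h A g ℓ ℓg β lamBar muBar δ T O U x s lam mu τ)
    {c : ℝ} (hc : c = 1 / 2 * (ℓ * ‖A‖ ^ 2 * lamBar + muBar)) :
    ∃ a ∈ C, f a ≠ ⊤ ∧ MapClusterPt a atTop (fun n => x (n + 1)) ∧
      (0 : H) ∈ limitingSubdiff (addIndicator C (objective f h A g)) a ∧
      (0 : WithLp 2 (H × H)) ∈ limitingSubdiff (merit C f h A g c) (WithLp.toLp 2 (a, a)) ∧
      ∃ M, IsDescentSequence (merit C f h A g c) δ M (fun n => x (n + 1))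
        (fun n => realObjective f h A g (x (n + 2)) + c * ‖x (n + 2) - x (n + 1)‖ ^ 2) a
        (realObjective f h A g a) := by
  obtain ⟨a, haC, hfa, hcl, hv, h0, h0'⟩ := hS.exists_mapClusterPt hc
  have hc0 : 0 ≤ c := hc ▸ hS.coeff_nonneg
  obtain ⟨M, hM, hsub⟩ := hS.exists_subgradient_bound
  have hm : ∀ y ∈ C, f y ≠ ⊤ → ∀ z, merit C f h A g c (WithLp.toLp 2 (y, z)) =
      ((realObjective f h A g y + c * ‖y - z‖ ^ 2 : ℝ) : EReal) := fun y hy hfy z => by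
    rw [merit, WithLp.toLp_fst, WithLp.toLp_snd, addIndicator, if_pos hy, hS.objective_eq hy hfy,
      ← EReal.coe_add]
  -- The quadratic term adds the partial gradients `± 2c (x - y)`, hence at most `4 * c` times the
  -- last step to the norm.
  refine ⟨a, haC, hfa, hcl, h0, h0', M + 4 * c, hS.delta_pos, by positivity,
    fun n => hm _ (hS.mem _) (hS.f_succ_ne_top _) _, fun n => ?_, fun n => ?_, ?_, hv⟩
  · have h1 := hS.descent (hS.f_succ_ne_top (n + 1))
    rw [← hc] at h1
    simp only [add_assoc, Nat.reduceAdd, Nat.add_one_sub_one] at h1 ⊢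
    linarith
  · obtain ⟨w, hw, hwM⟩ := hsub (n + 1)
    refine ⟨_, mem_limitingSubdiff_of_mem_frechetSubdiff
      (toLp_mem_frechetSubdiff hc0 (y := x (n + 2)) hw), ?_⟩
    simp only [add_assoc, Nat.reduceAdd] at hwM ⊢
    set d := x (n + 3) - x (n + 2)
    have e : WithLp.toLp 2 (w + (2 * c) • d, -((2 * c) • d)) =
        WithLp.toLp 2 (w + (2 * c) • d, 0) + WithLp.toLp 2 (0, -((2 * c) • d)) := by
      rw [← WithLp.toLp_add]; simp
    rw [e]
    refine (norm_add_le _ _).trans ?_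
    rw [WithLp.norm_toLp_fst, WithLp.norm_toLp_snd, norm_neg]
    have n1 := norm_add_le w ((2 * c) • d)
    have n2 : ‖(2 * c) • d‖ = 2 * c * ‖d‖ := by
      rw [norm_smul, Real.norm_eq_abs, abs_of_nonneg (by positivity)]
    have n3 : 0 ≤ c * ‖x (n + 2) - x (n + 1)‖ := by positivity
    rw [n2] at n1 ⊢
    linarith
  · rw [hm a haC hfa, sub_self, norm_zero]
    simp

end IsProxSetting

end Convergence

end ProxSubgrad

/-! ### Convergence and the three rate regimes -/

theorem theorem3p2
    {H K : Type*} [NormedAddCommGroup H] [InnerProductSpace ℝ H] [CompleteSpace H]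
    [FiniteDimensional ℝ H]
    [NormedAddCommGroup K] [InnerProductSpace ℝ K] [CompleteSpace K] [FiniteDimensional ℝ K]
    -- the data of the problem
    (C : Set H) (f : H → EReal) (h : K → ℝ) (A : H →L[ℝ] K) (g : H → EReal)
    (hC : IsClosed C)
    (hf_bot : ∀ x, f x ≠ ⊥) (hf_lsc : LowerSemicontinuous f)
    (hCf : (C ∩ ProxSubgrad.dom f).Nonempty)
    (ℓ : ℝ≥0) (hh : Differentiable ℝ h) (hh_lip : LipschitzWith ℓ (gradient h))
    (β : ℝ) (hβ : 0 ≤ β) (O : Set H) (hO : IsOpen O) (hO_conv : Convex ℝ O) (hCO : C ⊆ O)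
    (hg_bot : ∀ x, g x ≠ ⊥) (hg_fin : ∀ x ∈ O, g x ≠ ⊤)
    (hg_cont : ContinuousOn g O)
    (hg_conv : ConvexOn ℝ O (fun x => (g x).toReal + β / 2 * ‖x‖ ^ 2))
    -- the sequence generated by the algorithm
    (lamBar muBar δ : ℝ) (hlamBar : 0 ≤ lamBar) (hmuBar : 0 ≤ muBar) (hδ : 0 < δ)
    (x s : ℕ → H) (lam mu τ : ℕ → ℝ)
    (hx : ProxSubgrad.IsAlgorithmSequence C f h A g β ℓ lamBar muBar δ x s lam mu τ)
    -- the assumptions of the theorem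
    (hF_bdd : ∃ m : ℝ, ∀ y ∈ C, (m : EReal) ≤ ProxSubgrad.objective f h A g y)
    (hC0 : Bornology.IsBounded
      {y | y ∈ C ∧ ProxSubgrad.objective f h A g y ≤ ProxSubgrad.objective f h A g (x 0)})
    (U : Set H) (hU : IsOpen U) (hCU : C ∩ ProxSubgrad.dom f ⊆ U) (hg_finU : ∀ y ∈ U, g y ≠ ⊤)
    (hg_diff : DifferentiableOn ℝ (fun y => (g y).toReal) U)
    (ℓg : ℝ≥0)
    (hg_lip : LipschitzOnWith ℓg (gradient (fun y => (g y).toReal)) (C ∩ ProxSubgrad.dom f))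
    (hτ : 0 < liminf τ atTop)
    (c : ℝ) (hc : c = 1 / 2 * (ℓ * ‖A‖ ^ 2 * lamBar + muBar))
    (G : WithLp 2 (H × H) → EReal) (hG : G = ProxSubgrad.merit C f h A g c)
    (hKL : ∀ y ∈ C ∩ ProxSubgrad.dom f,
      WithLp.toLp 2 (y, y) ∈ ProxSubgrad.domLimitingSubdiff G →
        ProxSubgrad.KLProperty G (WithLp.toLp 2 (y, y))) :
    ∃ xstar : H,
      -- the whole sequence has finite length and converges to a stationary point
      ProxSubgrad.IsStationaryPoint C f h A g xstar ∧
      Tendsto x atTop (𝓝 xstar) ∧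
      Summable (fun n => ‖x (n + 1) - x n‖) ∧
      -- rates of convergence under a KL exponent
      ∀ θ : ℝ, 0 ≤ θ → θ < 1 →
        (∀ y ∈ C ∩ ProxSubgrad.dom f,
          WithLp.toLp 2 (y, y) ∈ ProxSubgrad.domLimitingSubdiff G →
            ProxSubgrad.KLPropertyWithExponent G (WithLp.toLp 2 (y, y)) θ) →
        (θ = 0 → ∃ N : ℕ, ∀ n, N ≤ n → x n = xstar) ∧
        (0 < θ → θ ≤ 1 / 2 → ∃ γ ρ : ℝ, 0 < γ ∧ 0 < ρ ∧ ρ < 1 ∧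
          (∀ n : ℕ, ‖x n - xstar‖ ≤ γ * ρ ^ ((n : ℝ) / 2)) ∧
          (∀ n : ℕ, (1 ≤ n ∨ x 0 ∈ ProxSubgrad.dom f) →
            (ProxSubgrad.objective f h A g (x n) - ProxSubgrad.objective f h A g xstar).abs
              ≤ ENNReal.ofReal (γ * ρ ^ n))) ∧
        (1 / 2 < θ → ∃ γ : ℝ, 0 < γ ∧
          ∀ n : ℕ, 1 ≤ n →
            ‖x n - xstar‖ ≤ γ * (n : ℝ) ^ (-((1 - θ) / (2 * θ - 1))) ∧
            (ProxSubgrad.objective f h A g (x n) - ProxSubgrad.objective f h A g xstar).abs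
              ≤ ENNReal.ofReal (γ * (n : ℝ) ^ (-((2 - 2 * θ) / (2 * θ - 1))))) := by
  obtain ⟨T, hT⟩ : ∃ T : ℝ, ∀ n, 1 / τ n ≤ T := by
    have hbdd : IsBoundedUnder (· ≥ ·) atTop τ :=
      isBoundedUnder_of ⟨0, fun n => (hx.tau_mem n).1.le⟩
    obtain ⟨N, hN⟩ := eventually_atTop.1 (eventually_lt_of_lt_liminf (half_lt_self hτ) hbdd)
    -- Eventually `τ` exceeds half its positive limit inferior; the finitely many earlier step sizes
    -- are positive, so one constant bounds all inverses.
    obtain ⟨T, -, hT⟩ := ProxSubgrad.exists_forall_le_of_eventually_le (u := fun _ => 1) (v := τ)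
      (γ := 1 / (liminf τ atTop / 2)) (N := N) (n₀ := 0) (fun n _ => (hx.tau_mem n).1)
      (fun n hn => by
        rw [one_div_mul_eq_div, le_div_iff₀ (half_pos hτ), one_mul]
        exact (hN n hn).le)
    exact ⟨T, fun n => (div_le_iff₀ (hx.tau_mem n).1).2 (hT T le_rfl n (Nat.zero_le n))⟩
  have hS : ProxSubgrad.IsProxSetting C f h A g ℓ ℓg β lamBar muBar δ T O U x s lam mu τ :=
    ⟨hC, hf_bot, hf_lsc, hCf, hh, hh_lip, hβ, hO, hCO, hg_bot, hg_fin, hg_cont, hg_conv, hlamBar,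
      hmuBar, hδ, hx, hF_bdd, hC0, hU, hCU, hg_diff, hg_lip, hT⟩
  have hc0 : 0 ≤ c := hc ▸ hS.coeff_nonneg
  obtain ⟨a, haC, hfa, hcl, h0, h0', M, hd⟩ := hS.exists_isDescentSequence hc
  subst hG
  have haD : a ∈ C ∩ ProxSubgrad.dom f := ⟨haC, lt_top_iff_ne_top.2 hfa⟩
  obtain ⟨hlim, hsum⟩ := hd.tendsto_of_mapClusterPt hcl (hKL a haD ⟨0, h0'⟩)
  refine ⟨a, ⟨haC, h0⟩, (tendsto_add_atTop_iff_nat 1).1 hlim,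
    (summable_nat_add_iff (f := fun n => ‖x (n + 1) - x n‖) 1).1 hsum, fun θ hθ0 hθ1 hKLθ => ?_⟩
  have hKLa := hKLθ a haD ⟨0, h0'⟩
  have habs : ∀ n, f (x n) ≠ ⊤ → ∀ t : ℝ, |ProxSubgrad.realObjective f h A g (x n) -
      ProxSubgrad.realObjective f h A g a| ≤ t → (ProxSubgrad.objective f h A g (x n) -
        ProxSubgrad.objective f h A g a).abs ≤ ENNReal.ofReal t := fun n hn t ht => by
    rw [hS.objective_eq (hS.mem n) hn, hS.objective_eq haC hfa, ← EReal.coe_sub, EReal.abs_def]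
    exact ENNReal.ofReal_le_ofReal ht
  have hfin : ∀ n, 1 ≤ n → f (x n) ≠ ⊤ := fun n hn => by
    have := hS.f_succ_ne_top (n - 1)
    rwa [Nat.sub_add_cancel hn] at this
  set r : ℕ → ℝ := fun n => ProxSubgrad.realObjective f h A g (x (n + 2)) +
    c * ‖x (n + 2) - x (n + 1)‖ ^ 2 - ProxSubgrad.realObjective f h A g a with hr
  have hr0 : ∀ n, 0 ≤ r n := fun n => sub_nonneg.2 (hd.le_value n)
  have hranti : Antitone r := fun i j hij => sub_le_sub_right (hd.antitone hij) _
  have hrate : 0 < θ → ∃ K > 0, ∃ D ≥ 0, ∃ N, ∀ n, N ≤ n →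
      r (n + 2) ^ (2 * θ) ≤ K * (r n - r (n + 2)) ∧ r n ≤ 1 ∧
      ‖x (n + 4) - a‖ ≤ D * (r n ^ (1 - θ) + √(r n)) ∧
      |ProxSubgrad.realObjective f h A g (x (n + 4)) - ProxSubgrad.realObjective f h A g a| ≤
        D * r n := fun hθ => by
    obtain ⟨K, hK, D, hD, N, hN⟩ := hd.exists_gap_recursion hlim hθ hθ1 hKLa hc0
    refine ⟨K, hK, D, hD, N, fun n hn => ?_⟩
    obtain ⟨h1, h2, h3, h4⟩ := hN n hn
    refine ⟨h1, h2, h3, le_trans (le_of_eq ?_) h4⟩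
    simp only [add_assoc, Nat.reduceAdd]
    congr 1
    ring
  refine ⟨?_, ?_, ?_⟩
  · rintro rfl
    obtain ⟨N, hN⟩ := hd.eventually_eq_of_exponent_zero hlim hKLa
    refine ⟨N + 1, fun n hn => ?_⟩
    have := hN (n - 1) (by omega)
    rwa [Nat.sub_add_cancel (by omega)] at this
  · intro hθ hθ2
    obtain ⟨K, hK, D, hD, N, hN⟩ := hrate hθ
    obtain ⟨γ, ρ, hγ, hρ, hρ1, hu, hw⟩ := ProxSubgrad.exists_linear_rate (r := r)
      (u := fun n => ‖x n - a‖) (w := fun n => |ProxSubgrad.realObjective f h A g (x n) -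
        ProxSubgrad.realObjective f h A g a|) hr0 hK (D := 2 * D) (by positivity) (N := N)
      (fun n hn => by
        -- Since `r ≤ 1` and `2 * θ ≤ 1`, one has `r ≤ r ^ (2 * θ)`, so the recursion becomes
        -- linear; likewise `√r` dominates `r ^ (1 - θ)` in the distance estimate.
        refine le_trans ?_ (hN n hn).1
        have := Real.rpow_le_rpow_of_exponent_ge' (hr0 (n + 2)) (hN (n + 2) (by omega)).2.1
          (by positivity : 0 ≤ 2 * θ) (by linarith : 2 * θ ≤ 1)
        rwa [Real.rpow_one] at this)
      (fun n hn => by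
        have h1 := Real.rpow_le_rpow_of_exponent_ge' (hr0 n) (hN n hn).2.1
          (by norm_num : (0 : ℝ) ≤ 1 / 2) (by linarith : 1 / 2 ≤ 1 - θ)
        rw [← Real.sqrt_eq_rpow] at h1
        have h2 := mul_le_mul_of_nonneg_left h1 hD
        linarith [(hN n hn).2.2.1])
      (fun n hn => by
        have h1 := mul_nonneg hD (hr0 n)
        linarith [(hN n hn).2.2.2])
    refine ⟨γ, ρ, hγ, hρ, hρ1, hu, fun n hn => habs n ?_ _ (hw n)⟩
    rcases Nat.eq_zero_or_pos n with rfl | hn0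
    · rcases hn with hn | hn
      · omega
      · exact hn.ne
    · exact hfin n hn0
  · intro hθ
    obtain ⟨K, hK, D, hD, N, hN⟩ := hrate (by linarith)
    obtain ⟨γ, hγ, huw⟩ := ProxSubgrad.exists_sublinear_rate (r := r) (θ := θ)
      (u := fun n => ‖x n - a‖) (w := fun n => |ProxSubgrad.realObjective f h A g (x n) -
        ProxSubgrad.realObjective f h A g a|) hr0 hranti hK (D := 2 * D) (by positivity) hθ hθ1
      (N := N) (fun n hn => (hN n hn).1)
      (fun n hn => by
        -- For `θ > 1 / 2` the dominance is reversed: `√r ≤ r ^ (1 - θ)`.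
        have h1 := Real.rpow_le_rpow_of_exponent_ge' (hr0 n) (hN n hn).2.1
          (by linarith : 0 ≤ 1 - θ) (by linarith : 1 - θ ≤ 1 / 2)
        rw [← Real.sqrt_eq_rpow] at h1
        have h2 := mul_le_mul_of_nonneg_left h1 hD
        linarith [(hN n hn).2.2.1])
      (fun n hn => by
        have h1 := Real.rpow_le_rpow_of_exponent_ge' (hr0 n) (hN n hn).2.1
          (by linarith : 0 ≤ 2 - 2 * θ) (by linarith : 2 - 2 * θ ≤ 1)
        rw [Real.rpow_one] at h1
        have h2 := mul_le_mul_of_nonneg_left h1 hD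
        have h3 := mul_nonneg hD (hr0 n)
        linarith [(hN n hn).2.2.2])
    exact ⟨γ, hγ, fun n hn => ⟨(huw n hn).1, habs n (hfin n hn) _ (huw n hn).2⟩⟩
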